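/- Let $d\ge 1$ and $p\ge 1$ be integers with $p(d-2)<d$, and let $B\subset\mathbb{R}^d$ be open; assume that either $B$ is bounded, or $B=\mathbb{R}^d$ and $d\ge 3$. Let $\mathcal D(B)=H^1_0(B)$ (the closure of $C_c^\infty(B)$ in $H^1(B)$) if $B$ is bounded, and let $\mathcal D(\mathbb{R}^d)=D^1(\mathbb{R}^d)$ be the set of $\psi\in L^1_{\rm loc}(\mathbb{R}^d)$ with distributional gradient in $L^2(\mathbb{R}^d)$ which vanish at infinity, i.e. $\{x:|\psi(x)|>a\}$ has finite Lebesgue measure for every $a>0$. All functions are real-valued. Let $\phi=(\phi_1,\dots,\phi_n)$ be a family of nonnegative bounded measurable functions with compact support in $B$, at least one of which is not almost everywhere zero, and let $$\Theta(\phi)=\inf\Big\{\frac p2\|\nabla\psi\|_2^2 \,:\, \psi\in\mathcal D(B),\ \sum_{i=1}^n\|\phi_i\psi\|_{2p}^2=1\Big\},$$ where $\|\cdot\|_q$ is the norm of $L^q(B)$. Then the infimum is attained: there is a minimiser, i.e. some $\psi\in\mathcal D(B)$ with $\sum_{i=1}^n\|\phi_i\psi\|_{2p}^2=1$ and $\frac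 p2\|\nabla\psi\|_2^2=\Theta(\phi)$. Moreover, every minimiser $\psi$ solves, in the sense of distributions on $B$, the nonlinear equation $$-\frac p2\Delta\psi=\Theta(\phi)\,\psi^{2p-1}\sum_{i=1}^n\|\phi_i\psi\|_{2p}^{2-2p}\,\phi_i^{2p},$$ whose right-hand side is locally integrable on $B$; here, if $p\ge 2$, terms with $\|\phi_i\psi\|_{2p}=0$ are read as $0$. -/

import Mathlib

open MeasureTheory Filter Topology
open scoped ENNReal Distributions InnerProductSpace Laplacian

noncomputable section

namespace IntersectionLocalTime

/-- Euclidean space of dimension `d`. -/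
abbrev E (d : ℕ) : Type := EuclideanSpace ℝ (Fin d)

/-- Lebesgue measure restricted to the open set `B`. -/
abbrev leb {d : ℕ} (B : TopologicalSpace.Opens (E d)) : Measure (E d) :=
  volume.restrict (B : Set (E d))

/-- The locally integrable field `g` is the distributional (weak) gradient of the locally
integrable function `ψ` on the open set `B`; here `𝓓(B, ℝ)` is the space of smooth functions with
compact support in `B`. Only the values of `ψ` and `g` on `B` matter. -/
structure HasWeakGradient {d : ℕ} (B : TopologicalSpace.Opens (E d))
    (ψ : E d → ℝ) (g : E d → E d) : Prop where
  locallyIntegrable : LocallyIntegrableOn ψ (B : Set (E d)) volume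
  locallyIntegrable_grad : LocallyIntegrableOn g (B : Set (E d)) volume
  integral_eq : ∀ (η : 𝓓(B, ℝ)) (j : Fin d),
    ∫ x in (B : Set (E d)), ψ x * fderiv ℝ η x (EuclideanSpace.single j 1)
      = - ∫ x in (B : Set (E d)), g x j * η x

/-- `ψ` belongs to `H¹₀(B)` and has weak gradient `g`: both are square integrable on `B`, and `ψ`
is a limit of smooth functions with compact support in `B` in the Sobolev norm of `H¹(B)`. -/
structure HasH10Gradient {d : ℕ} (B : TopologicalSpace.Opens (E d))
    (ψ : E d → ℝ) (g : E d → E d) : Prop where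
  weakGradient : HasWeakGradient B ψ g
  memLp : MemLp ψ 2 (leb B)
  memLp_grad : MemLp g 2 (leb B)
  approx : ∃ η : ℕ → 𝓓(B, ℝ), Tendsto
    (fun k => eLpNorm (fun x => gradient (η k) x - g x) 2 (leb B) ^ 2
      + eLpNorm (fun x => η k x - ψ x) 2 (leb B) ^ 2) atTop (𝓝 0)

/-- `ψ` belongs to `D¹(ℝᵈ)` and has weak gradient `g`: `ψ` is locally integrable, it vanishes at
infinity in the sense that `{|ψ| > a}` has finite Lebesgue measure for every `a > 0`, and its
distributional gradient `g` is square integrable. -/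
structure HasD1Gradient {d : ℕ} (ψ : E d → ℝ) (g : E d → E d) : Prop where
  weakGradient : HasWeakGradient ⊤ ψ g
  vanish : ∀ a : ℝ, 0 < a → volume {x : E d | a < |ψ x|} < ∞
  memLp_grad : MemLp g 2 volume

/-- `ψ` belongs to the space `𝒟(B)` and `∇ψ = g`, where `𝒟(B)` is `H¹₀(B)` if `B` is bounded and
`D¹(ℝᵈ)` if `B = ℝᵈ`. -/
def HasDGradient {d : ℕ} (B : TopologicalSpace.Opens (E d)) (ψ : E d → ℝ) (g : E d → E d) : Prop :=
  (Bornology.IsBounded (B : Set (E d)) ∧ HasH10Gradient B ψ g) ∨ (B = ⊤ ∧ HasD1Gradient ψ g)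

/-- `‖f ψ‖_{2p}`, the norm of `L^{2p}(B)`. -/
def weightedNorm {d : ℕ} (B : TopologicalSpace.Opens (E d)) (p : ℕ) (f ψ : E d → ℝ) : ℝ≥0∞ :=
  eLpNorm (fun x => f x * ψ x) ((2 * p : ℕ) : ℝ≥0∞) (leb B)

/-- The constraint `∑ᵢ ‖φᵢ ψ‖²_{2p} = 1`. -/
def Constraint {d n : ℕ} (B : TopologicalSpace.Opens (E d)) (p : ℕ) (φ : Fin n → E d → ℝ)
    (ψ : E d → ℝ) : Prop :=
  ∑ i, weightedNorm B p (φ i) ψ ^ 2 = 1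

/-- `(p / 2) ‖g‖₂²`, the norm of `L²(B)`. -/
def energy {d : ℕ} (B : TopologicalSpace.Opens (E d)) (p : ℕ) (g : E d → E d) : ℝ :=
  (p : ℝ) / 2 * (eLpNorm g 2 (leb B)).toReal ^ 2

/-- `Θ(φ)`, the infimum of `(p / 2) ‖∇ψ‖₂²` over all `ψ ∈ 𝒟(B)` that satisfy the constraint. -/
def Theta {d n : ℕ} (B : TopologicalSpace.Opens (E d)) (p : ℕ) (φ : Fin n → E d → ℝ) : ℝ :=
  sInf {t : ℝ | ∃ (ψ : E d → ℝ) (g : E d → E d),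
    HasDGradient B ψ g ∧ Constraint B p φ ψ ∧ t = energy B p g}

/-- `ψ` is a minimiser of the variational problem that defines `Θ(φ)`. -/
def IsMinimiser {d n : ℕ} (B : TopologicalSpace.Opens (E d)) (p : ℕ) (φ : Fin n → E d → ℝ)
    (ψ : E d → ℝ) : Prop :=
  ∃ g : E d → E d, HasDGradient B ψ g ∧ Constraint B p φ ψ ∧ energy B p g = Theta B p φ

/-- `-c Δψ = f` on `B` in the sense of distributions. -/
structure SolvesPoisson {d : ℕ} (B : TopologicalSpace.Opens (E d)) (c : ℝ) (ψ f : E d → ℝ) :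
    Prop where
  locallyIntegrable : LocallyIntegrableOn ψ (B : Set (E d)) volume
  locallyIntegrable_rhs : LocallyIntegrableOn f (B : Set (E d)) volume
  integral_eq : ∀ η : 𝓓(B, ℝ),
    -c * ∫ x in (B : Set (E d)), ψ x * Δ (η : E d → ℝ) x = ∫ x in (B : Set (E d)), f x * η x

/-- `Θ(φ) ψ^{2p-1} ∑ᵢ ‖φᵢ ψ‖_{2p}^{2-2p} φᵢ^{2p}`. For `p ≥ 2` and `‖φᵢ ψ‖_{2p} = 0`, the
convention `0⁻¹ = 0` makes the `i`-th term vanish; in that case `ψ^{2p-1} φᵢ^{2p}` is zero almost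
everywhere. -/
def rightHandSide {d n : ℕ} (B : TopologicalSpace.Opens (E d)) (p : ℕ) (φ : Fin n → E d → ℝ)
    (ψ : E d → ℝ) : E d → ℝ := fun x =>
  Theta B p φ * ψ x ^ (2 * p - 1) *
    ∑ i, (weightedNorm B p (φ i) ψ).toReal ^ (2 - 2 * (p : ℤ)) * φ i x ^ (2 * p)

end IntersectionLocalTime

end

/-!
The proof replaces the minimisation by the dual maximisation over test functions. Let `Λ` be the
best constant in `∑ᵢ ‖φᵢ u‖²_{2p} ≤ Λ ‖∇u‖₂²` for `u ∈ C_c^∞(B)`.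

*Compactness.* Since `p (d - 2) < d`, the Sobolev inequality bounds `‖u‖_r` by `‖∇u‖₂` for some
`r > 2p` (`exists_sobolev`); in particular `Λ` is finite. A sequence of test functions with bounded
gradients has a subsequence that is Cauchy in `L²` of every fixed ball
(`exists_subseq_cauchy_closedBall`): mollification at scale `ε` moves it by at most `ε ‖∇u‖₂`, and
mollifications of weakly convergent sequences converge strongly on balls. Interpolation between `L²`
and `L^r` then gives Cauchy sequences for the weighted `L^{2p}` norms
(`exists_subseq_weightedNorm_cauchy`).

*Existence.* Take test functions `uₖ` with `‖∇uₖ‖₂ ≤ 1` whose constraint functional tends to `Λ`.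
Along the subsequence above the functional of `uₖ + uₗ` tends to `4 Λ`, so `‖∇(uₖ + uₗ)‖₂² → 4`, and
the parallelogram law makes the gradients Cauchy in `L²` (`cauchySeq_gradLp`). No weak lower
semicontinuity is needed: the `uₖ` converge strongly, in `L^r` by the Sobolev inequality, to an
element of `𝒟(B)` that attains `Λ` (`exists_maximiser`).

*All of `𝒟(B)`.* The inequality with constant `Λ` passes from test functions to every `ψ ∈ 𝒟(B)` by
Fatou's lemma (`constraintFun_le_of_hasDGradient`). For `H¹₀(B)` this is immediate. For `D¹(ℝᵈ)`,
where `ψ` is not known to be in any `L^q`, it takes three approximations: mollification, a smooth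
truncation of the values, which makes the function bounded with support of finite measure and hence
square integrable, and a cutoff in space. Hence `Θ = p / (2 Λ)`, attained by the normalised maximiser
(`isMinimiser_of_maximiser`).

*Euler–Lagrange equation.* For a minimiser `ψ` and a test function `η`, the function
`t ↦ energy (ψ + t η) - Θ ∑ᵢ ‖φᵢ (ψ + t η)‖²_{2p}` is nonnegative and vanishes at `0`; its derivative
there vanishes (`IsMinimiser.solvesPoisson`).
-/

namespace IntersectionLocalTime

section

open scoped Convolution

/-! ### Averages of square integrable functions, translations and mollification -/

lemma eLpNorm_two_sq {α V : Type*} [MeasurableSpace α] [NormedAddCommGroup V] (f : α → V)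
    (μ : Measure α) : eLpNorm f 2 μ ^ 2 = ∫⁻ x, ‖f x‖ₑ ^ 2 ∂μ := by
  have h := eLpNorm_nnreal_pow_eq_lintegral (f := f) (μ := μ) (p := 2) (by norm_num)
  simpa using h

/-- Minkowski's integral inequality in `L²`, for averages: an average of functions of norm at most
`A` has norm at most `A`. -/
lemma eLpNorm_integral_le {X Y V : Type*} [MeasurableSpace X] [MeasurableSpace Y]
    [NormedAddCommGroup V] [NormedSpace ℝ V] {μ : Measure X} [SFinite μ] {ν : Measure Y}
    [IsProbabilityMeasure ν] {F : X → Y → V}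
    (hF : AEStronglyMeasurable (Function.uncurry F) (μ.prod ν)) {A : ℝ≥0∞}
    (hA : ∀ᵐ y ∂ν, eLpNorm (fun x => F x y) 2 μ ≤ A) :
    eLpNorm (fun x => ∫ y, F x y ∂ν) 2 μ ≤ A := by
  rw [← ENNReal.pow_le_pow_left_iff two_ne_zero, eLpNorm_two_sq]
  calc ∫⁻ x, ‖∫ y, F x y ∂ν‖ₑ ^ 2 ∂μ ≤ ∫⁻ x, ∫⁻ y, ‖F x y‖ₑ ^ 2 ∂ν ∂μ := by
        refine lintegral_mono_ae (hF.prodMk_left.mono fun x hx => ?_)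
        rw [← eLpNorm_two_sq (fun y => F x y)]
        gcongr
        calc ‖∫ y, F x y ∂ν‖ₑ ≤ ∫⁻ y, ‖F x y‖ₑ ∂ν := enorm_integral_le_lintegral_enorm _
          _ = eLpNorm (fun y => F x y) 1 ν := eLpNorm_one_eq_lintegral_enorm.symm
          _ ≤ _ := eLpNorm_le_eLpNorm_of_exponent_le (by norm_num) hx
    _ = ∫⁻ y, ∫⁻ x, ‖F x y‖ₑ ^ 2 ∂μ ∂ν :=
        lintegral_lintegral_swap (hF.enorm.pow_const 2)
    _ ≤ ∫⁻ _, A ^ 2 ∂ν := by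
        refine lintegral_mono_ae (hA.mono fun y hy => ?_)
        rw [← eLpNorm_two_sq (fun x => F x y)]
        gcongr
    _ = A ^ 2 := by simp

variable {d : ℕ}

/-- Translation by `y` moves a `C¹` function by at most `‖y‖ ‖∇u‖₂` in `L²`. -/
lemma eLpNorm_translate_sub_le {u : E d → ℝ} (hu : ContDiff ℝ 1 u) (y : E d) :
    eLpNorm (fun x => u (x - y) - u x) 2 volume ≤ ‖y‖ₑ * eLpNorm (fderiv ℝ u) 2 volume := by
  have hfd : Continuous (fderiv ℝ u) := hu.continuous_fderiv one_ne_zero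
  have key : ∀ x, u (x - y) - u x
      = ∫ t in Set.Ioc (0:ℝ) 1, fderiv ℝ u (x - t • y) (-y) := by
    intro x
    rw [← intervalIntegral.integral_of_le zero_le_one]
    have hder : ∀ t ∈ Set.uIcc (0:ℝ) 1,
        HasDerivAt (fun t : ℝ => u (x - t • y)) (fderiv ℝ u (x - t • y) (-y)) t := by
      intro t _
      have h1 : HasDerivAt (fun t : ℝ => x - t • y) (-y) t := by
        simpa using ((hasDerivAt_id t).smul_const y).const_sub x
      exact ((hu.differentiable one_ne_zero).differentiableAt.hasFDerivAt).comp_hasDerivAt t h1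
    rw [intervalIntegral.integral_eq_sub_of_hasDerivAt hder]
    · simp
    · apply Continuous.intervalIntegrable
      fun_prop
  simp_rw [key]
  have : IsProbabilityMeasure (volume.restrict (Set.Ioc (0:ℝ) 1)) := ⟨by simp⟩
  refine eLpNorm_integral_le ?_ (Eventually.of_forall fun t => ?_)
  · apply Continuous.aestronglyMeasurable
    have : Continuous fun q : E d × ℝ => fderiv ℝ u (q.1 - q.2 • y) (-y) := by fun_prop
    exact this
  · calc eLpNorm (fun x => fderiv ℝ u (x - t • y) (-y)) 2 volume
        ≤ eLpNorm (‖y‖ • fun x => ‖fderiv ℝ u (x - t • y)‖) 2 volume := by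
          refine eLpNorm_mono fun x => ?_
          have := (fderiv ℝ u (x - t • y)).le_opNorm (-y)
          rw [norm_neg] at this
          simpa [mul_comm] using this
      _ = ‖y‖ₑ * eLpNorm (fun x => ‖fderiv ℝ u (x - t • y)‖) 2 volume := by
          rw [eLpNorm_const_smul]; simp
      _ = ‖y‖ₑ * eLpNorm (fderiv ℝ u) 2 volume := by
          rw [eLpNorm_norm]
          congr 1
          exact eLpNorm_comp_measurePreserving (g := fderiv ℝ u) hfd.aestronglyMeasurable
            (measurePreserving_sub_right volume (t • y))

/-- The mollification of `f` at scale `ρ.rOut`: its convolution with the bump function `ρ`,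
normalised to have integral `1`. -/
noncomputable def mollify {V : Type*} [NormedAddCommGroup V] [NormedSpace ℝ V]
    (ρ : ContDiffBump (0 : E d)) (f : E d → V) : E d → V :=
  ρ.normed volume ⋆[ContinuousLinearMap.lsmul ℝ ℝ, volume] f

/-- The probability measure with density the normalised bump function `ρ`. -/
noncomputable def bumpMeasure (ρ : ContDiffBump (0 : E d)) : Measure (E d) :=
  volume.withDensity fun y => ENNReal.ofReal (ρ.normed volume y)

instance (ρ : ContDiffBump (0 : E d)) : IsProbabilityMeasure (bumpMeasure ρ) := ⟨by
  rw [bumpMeasure, withDensity_apply _ MeasurableSet.univ, Measure.restrict_univ,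
    ← ofReal_integral_eq_lintegral_ofReal ρ.integrable_normed
      (Eventually.of_forall ρ.nonneg_normed), ρ.integral_normed, ENNReal.ofReal_one]⟩

lemma aestronglyMeasurable_translates {V : Type*} [NormedAddCommGroup V]
    (ρ : ContDiffBump (0 : E d)) {f : E d → V} (hf : AEStronglyMeasurable f volume) :
    AEStronglyMeasurable (Function.uncurry fun x y => f (x - y)) (volume.prod (bumpMeasure ρ)) :=
  hf.comp_quasiMeasurePreserving
    (quasiMeasurePreserving_sub_of_right_invariant volume (bumpMeasure ρ))

section Mollify

variable {V : Type*} [NormedAddCommGroup V] [NormedSpace ℝ V] (ρ : ContDiffBump (0 : E d))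

lemma integral_bumpMeasure (f : E d → V) :
    ∫ y, f y ∂(bumpMeasure ρ) = ∫ y, ρ.normed volume y • f y := by
  rw [bumpMeasure, integral_withDensity_eq_integral_toReal_smul]
  · simp only [ENNReal.toReal_ofReal (ρ.nonneg_normed _)]
  · exact (ρ.continuous_normed.measurable).ennreal_ofReal
  · exact Eventually.of_forall fun _ => ENNReal.ofReal_lt_top

lemma mollify_apply (f : E d → V) (x : E d) :
    mollify ρ f x = ∫ y, ρ.normed volume y • f (x - y) := rfl

lemma mollify_eq_integral (f : E d → V) (x : E d) :
    mollify ρ f x = ∫ y, f (x - y) ∂(bumpMeasure ρ) := by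
  rw [integral_bumpMeasure, mollify_apply]

lemma mollify_apply_swap (f : E d → V) (x : E d) :
    mollify ρ f x = ∫ y, ρ.normed volume (x - y) • f y := by
  rw [mollify_apply, ← integral_sub_left_eq_self _ volume x]
  simp

lemma eLpNorm_mollify_le {f : E d → V} (hf : AEStronglyMeasurable f volume) :
    eLpNorm (mollify ρ f) 2 volume ≤ eLpNorm f 2 volume := by
  have : mollify ρ f = fun x => ∫ y, f (x - y) ∂(bumpMeasure ρ) :=
    funext fun x => mollify_eq_integral ρ f x
  rw [this]
  refine eLpNorm_integral_le (aestronglyMeasurable_translates ρ hf)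
    (Eventually.of_forall fun y => le_of_eq ?_)
  exact eLpNorm_comp_measurePreserving hf (measurePreserving_sub_right volume y)

lemma integrable_normed_smul_translate {f : E d → V} (hf : LocallyIntegrable f volume) (x : E d) :
    Integrable (fun y => ρ.normed volume y • f (x - y)) volume :=
  (ρ.hasCompactSupport_normed.convolutionExists_left (ContinuousLinearMap.lsmul ℝ ℝ)
    ρ.continuous_normed hf) x

lemma ae_bumpMeasure_norm_le : ∀ᵐ y ∂(bumpMeasure ρ), ‖y‖ ≤ ρ.rOut := by
  rw [bumpMeasure, ae_withDensity_iff (ρ.continuous_normed.measurable).ennreal_ofReal]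
  refine Eventually.of_forall fun y hy => ?_
  have h1 : y ∈ Function.support (ρ.normed volume) := by
    intro h0
    simp [h0] at hy
  rw [ρ.support_normed_eq] at h1
  exact (mem_ball_zero_iff.1 h1).le

/-- If small translations move `f` by at most `A` in `L²`, then so does mollification. -/
lemma eLpNorm_mollify_sub_le {f : E d → V} [CompleteSpace V] (hf : LocallyIntegrable f volume)
    {A : ℝ≥0∞}
    (hA : ∀ y : E d, ‖y‖ ≤ ρ.rOut → eLpNorm (fun x => f (x - y) - f x) 2 volume ≤ A) :
    eLpNorm (fun x => mollify ρ f x - f x) 2 volume ≤ A := by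
  have hm := hf.aestronglyMeasurable
  have : (fun x => mollify ρ f x - f x) = fun x => ∫ y, (f (x - y) - f x) ∂(bumpMeasure ρ) := by
    funext x
    rw [integral_bumpMeasure]
    simp_rw [smul_sub]
    rw [integral_sub (integrable_normed_smul_translate ρ hf x)
      (ρ.integrable_normed.smul_const _), ρ.integral_normed_smul, mollify_apply]
  rw [this]
  refine eLpNorm_integral_le ((aestronglyMeasurable_translates ρ hm).sub hm.comp_fst) ?_
  exact (ae_bumpMeasure_norm_le ρ).mono fun y hy => hA y hy

/-- Mollification at scale `ρ.rOut` moves a `C¹` function by at most `ρ.rOut ‖∇u‖₂` in `L²`. -/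
lemma eLpNorm_mollify_sub_le_fderiv {u : E d → ℝ} (hu : ContDiff ℝ 1 u) :
    eLpNorm (fun x => mollify ρ u x - u x) 2 volume
      ≤ ENNReal.ofReal ρ.rOut * eLpNorm (fderiv ℝ u) 2 volume := by
  refine eLpNorm_mollify_sub_le ρ hu.continuous.locallyIntegrable fun y hy => ?_
  refine (eLpNorm_translate_sub_le hu y).trans ?_
  gcongr
  rw [← ofReal_norm]
  exact ENNReal.ofReal_le_ofReal hy

end Mollify

end

section

lemma eLpNorm_restrict_eq_of_forall_notMem {α V : Type*} [MeasurableSpace α]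
    [NormedAddCommGroup V] {μ : Measure α} {f : α → V} {s : Set α} {q : ℝ≥0∞}
    (h : ∀ x ∉ s, f x = 0) : eLpNorm f q (μ.restrict s) = eLpNorm f q μ :=
  eLpNorm_restrict_eq_of_support_subset fun x hx => by
    by_contra hxs
    exact hx (h x hxs)

/-! ### The Sobolev inequality in the subcritical range -/

open Module in
/-- On the line, the supremum of a compactly supported function is at most the `L¹` norm of its
derivative. -/
lemma enorm_le_lintegral_fderiv_of_dim_one {u : E 1 → ℝ} (hu : ContDiff ℝ 1 u)
    (hc : HasCompactSupport u) (x : E 1) : ‖u x‖ₑ ≤ ∫⁻ y, ‖fderiv ℝ u y‖ₑ := by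
  let L : ℝ ≃ₗᵢ[ℝ] E 1 := (OrthonormalBasis.singleton (Fin 1) ℝ).repr
  have hL : ContDiff ℝ 1 (L : ℝ → E 1) := L.contDiff
  have hmp : MeasurePreserving (L : ℝ → E 1) volume volume := L.measurePreserving
  have h1 := (hc.comp_homeomorph L.toHomeomorph).enorm_le_lintegral_Ici_deriv
    (f := u ∘ L) (hu.comp hL) (L.symm x)
  have h2 : (u ∘ L) (L.symm x) = u x := by simp
  rw [h2] at h1
  refine h1.trans ((setLIntegral_le_lintegral _ _).trans ?_)
  rw [← hmp.lintegral_comp ((hu.continuous_fderiv one_ne_zero).enorm.measurable)]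
  refine lintegral_mono fun t => ?_
  have hd : HasDerivAt (u ∘ L) (fderiv ℝ u (L t) (L 1)) t := by
    have hL' : HasDerivAt (L : ℝ → E 1) (L 1) t := by
      have := (L.toContinuousLinearEquiv.toContinuousLinearMap.hasFDerivAt (x := t)).hasDerivAt
      simpa using this
    exact ((hu.differentiable one_ne_zero).differentiableAt.hasFDerivAt).comp_hasDerivAt t hL'
  rw [hd.deriv, enorm_le_iff_norm_le]
  refine ((fderiv ℝ u (L t)).le_opNorm _).trans ?_
  simp

variable {d : ℕ}

lemma TestFunction.contDiff_one {B : TopologicalSpace.Opens (E d)} (u : 𝓓(B, ℝ)) :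
    ContDiff ℝ 1 (u : E d → ℝ) := u.contDiff.of_le (by exact_mod_cast le_top)

/-- The Sobolev inequality: since `p (d - 2) < d`, the Dirichlet norm of a test function controls
its norm in `Lʳ` for some `r > 2p`. -/
lemma exists_sobolev (hd : 1 ≤ d) {p : ℕ} (hp : 1 ≤ p)
    (hpd : (p : ℤ) * ((d : ℤ) - 2) < (d : ℤ)) {B : TopologicalSpace.Opens (E d)}
    (hB : Bornology.IsBounded (B : Set (E d)) ∨ (B = ⊤ ∧ 3 ≤ d)) :
    ∃ r : NNReal, 2 * (p : ℝ) < r ∧ ∃ C : NNReal, ∀ u : 𝓓(B, ℝ),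
      eLpNorm u r volume ≤ C * eLpNorm (fderiv ℝ u) 2 volume := by
  have hp' : (1:ℝ) ≤ p := by exact_mod_cast hp
  rcases Nat.lt_or_ge d 3 with h3 | h3
  swap
  · -- the critical exponent `2d / (d - 2)`
    have hd3 : (3:ℝ) ≤ d := by exact_mod_cast h3
    have hpd' : (p:ℝ) * (d - 2) < d := by exact_mod_cast hpd
    refine ⟨NNReal.mk (2 * d / (d - 2)) (div_nonneg (by linarith) (by linarith)), ?_, _,
      fun u => eLpNorm_le_eLpNorm_fderiv_of_eq volume (p := 2) (TestFunction.contDiff_one u)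
        u.hasCompactSupport (by norm_num) ?_ ?_⟩
    · rw [NNReal.coe_mk, lt_div_iff₀ (by linarith)]
      nlinarith
    · rw [finrank_euclideanSpace_fin]; omega
    · rw [finrank_euclideanSpace_fin, NNReal.coe_mk]
      have : (d:ℝ) - 2 ≠ 0 := by linarith
      field_simp
      push_cast
      ring
  · have hbd : Bornology.IsBounded (B : Set (E d)) := hB.resolve_right fun h => by omega
    have hfin : volume (B : Set (E d)) ≠ ∞ := hbd.measure_lt_top.ne
    -- Hölder's inequality on the bounded set `B`
    have holder : ∀ (u : 𝓓(B, ℝ)) (s : ℝ≥0∞), s ≤ 2 → eLpNorm (fderiv ℝ u) s volume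
        ≤ volume (B : Set (E d)) ^ (1 / s.toReal - 1 / 2) * eLpNorm (fderiv ℝ u) 2 volume := by
      intro u s hs
      have hsupp : ∀ x ∉ (B : Set (E d)), fderiv ℝ (u : E d → ℝ) x = 0 := fun x hx =>
        fderiv_of_notMem_tsupport ℝ fun h => hx (u.tsupport_subset h)
      rw [← eLpNorm_restrict_eq_of_forall_notMem hsupp,
        ← eLpNorm_restrict_eq_of_forall_notMem (q := 2) hsupp, mul_comm]
      have := eLpNorm_le_eLpNorm_mul_rpow_measure_univ (μ := volume.restrict (B : Set (E d))) hs
        ((TestFunction.contDiff_one u).continuous_fderiv one_ne_zero).aestronglyMeasurable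
      simpa using this
    obtain rfl | rfl : d = 1 ∨ d = 2 := by omega
    · refine ⟨2 * p + 1, by push_cast; linarith,
        (volume (B : Set (E 1)) ^ ((2 * p + 1 : ℝ)⁻¹) *
          volume (B : Set (E 1)) ^ (1 - 1 / 2 : ℝ)).toNNReal, fun u => ?_⟩
      rw [ENNReal.coe_toNNReal (ENNReal.mul_ne_top
        (ENNReal.rpow_ne_top_of_nonneg (by positivity) hfin)
        (ENNReal.rpow_ne_top_of_nonneg (by norm_num) hfin))]
      have hsupp : Function.support (u : E 1 → ℝ) ⊆ B :=
        (subset_tsupport _).trans u.tsupport_subset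
      have hone := holder u 1 (by norm_num)
      rw [eLpNorm_one_eq_lintegral_enorm, ENNReal.toReal_one, div_one] at hone
      rw [← eLpNorm_restrict_eq_of_support_subset hsupp, mul_assoc]
      refine (eLpNorm_le_of_ae_enorm_bound (C := ∫⁻ y, ‖fderiv ℝ (u : E 1 → ℝ) y‖ₑ)
        (Eventually.of_forall fun x => enorm_le_lintegral_fderiv_of_dim_one
          (TestFunction.contDiff_one u) u.hasCompactSupport x)).trans ?_
      simp only [Measure.restrict_apply_univ, ENNReal.coe_toReal, smul_eq_mul]
      push_cast
      rw [mul_comm]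
      gcongr
    · -- in the plane, use the exponent `s < 2` whose Sobolev conjugate is `r`
      set r : NNReal := 2 * p + 1 with hr
      have hr1 : (r:ℝ) = 2 * p + 1 := by rw [hr]; push_cast; ring
      set s : NNReal := 2 * r / (r + 2) with hs
      have hs1 : (s:ℝ) = 2 * r / (r + 2) := by rw [hs]; push_cast; ring
      have hrpos : (0:ℝ) < r := by rw [hr1]; linarith
      have hs2 : (s:ℝ) ≤ 2 := by
        rw [hs1, div_le_iff₀ (by positivity)]; linarith
      have h1s : (1:ℝ) ≤ s := by
        rw [hs1, le_div_iff₀ (by positivity)]; linarith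
      have hexp : (0:ℝ) ≤ 1 / (s:ℝ≥0∞).toReal - 1 / 2 := by
        rw [ENNReal.coe_toReal, sub_nonneg]
        exact one_div_le_one_div_of_le (by linarith) hs2
      refine ⟨r, by linarith, SNormLESNormFDerivOfEqConst ℝ (volume : Measure (E 2)) s *
        (volume (B : Set (E 2)) ^ (1 / (s:ℝ≥0∞).toReal - 1 / 2)).toNNReal, fun u => ?_⟩
      rw [ENNReal.coe_mul, ENNReal.coe_toNNReal (ENNReal.rpow_ne_top_of_nonneg hexp hfin),
        mul_assoc]
      refine (eLpNorm_le_eLpNorm_fderiv_of_eq volume (p := s) (TestFunction.contDiff_one u)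
        u.hasCompactSupport (by exact_mod_cast h1s) ?_ ?_).trans ?_
      · simp
      · rw [finrank_euclideanSpace_fin, NNReal.coe_inv, hs1]
        field_simp
        push_cast
        ring
      · gcongr
        exact holder u s (by exact_mod_cast hs2)

/-- Interpolation of `L^q` between `L²` and `L^r`. -/
lemma exists_eLpNorm_le_interpolation {q : ℕ} {r : NNReal} (hq : 2 ≤ q) (hqr : (q:ℝ) < r) :
    ∃ a b : ℝ, 0 < a ∧ 0 ≤ b ∧ ∀ {α : Type} [MeasurableSpace α] (μ : Measure α) (f : α → ℝ),
      AEStronglyMeasurable f μ → eLpNorm f q μ ≤ eLpNorm f 2 μ ^ a * eLpNorm f r μ ^ b := by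
  have hq' : (2:ℝ) ≤ q := by exact_mod_cast hq
  have hq0 : (0:ℝ) < q := by linarith
  have hr0 : (0:ℝ) < r := by linarith
  have hr2 : (0:ℝ) < r - 2 := by linarith
  set α := ((r:ℝ) - q) / (r - 2) with hα
  set β := ((q:ℝ) - 2) / (r - 2) with hβ
  have hα0 : 0 < α := div_pos (by linarith) hr2
  have hβ0 : 0 ≤ β := div_nonneg (by linarith) hr2.le
  have hsum : α + β = 1 := by rw [hα, hβ]; field_simp; ring
  have hcomb : 2 * α + r * β = q := by rw [hα, hβ]; field_simp; ring
  refine ⟨2 * α / q, r * β / q, by positivity, by positivity, fun μ f hf => ?_⟩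
  have h := ENNReal.lintegral_mul_norm_pow_le (μ := μ) (f := fun x => ‖f x‖ₑ ^ (2:ℝ))
    (g := fun x => ‖f x‖ₑ ^ (r:ℝ)) (hf.enorm.pow_const _) (hf.enorm.pow_const _) hα0.le hβ0 hsum
  have hlhs : ∀ x, (‖f x‖ₑ ^ (2:ℝ)) ^ α * (‖f x‖ₑ ^ (r:ℝ)) ^ β = ‖f x‖ₑ ^ ((q : NNReal) : ℝ) := by
    intro x
    rw [← ENNReal.rpow_mul, ← ENNReal.rpow_mul,
      ← ENNReal.rpow_add_of_nonneg _ _ (by positivity) (by positivity), hcomb]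
    simp
  simp_rw [hlhs] at h
  have e2 := eLpNorm_nnreal_pow_eq_lintegral (f := f) (μ := μ) (p := 2) (by norm_num)
  have er := eLpNorm_nnreal_pow_eq_lintegral (f := f) (μ := μ) (p := r) (by
    rintro rfl; simp at hr0)
  have eq := eLpNorm_nnreal_pow_eq_lintegral (f := f) (μ := μ) (p := (q : NNReal)) (by
    have : q ≠ 0 := by omega
    exact_mod_cast this)
  simp only [NNReal.coe_ofNat, ENNReal.coe_ofNat, ENNReal.coe_natCast] at e2 er eq
  rw [← e2, ← er, ← eq] at h
  have h' := ENNReal.rpow_le_rpow h (z := (q:ℝ)⁻¹) (by positivity)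
  rw [ENNReal.mul_rpow_of_nonneg _ _ (by positivity)] at h'
  simp only [← ENNReal.rpow_mul, NNReal.coe_natCast] at h'
  rw [mul_inv_cancel₀ hq0.ne', ENNReal.rpow_one] at h'
  simpa [div_eq_mul_inv] using h'

/-! ### Local compactness -/

/-- Bounded sequences in a separable Hilbert space have weakly convergent subsequences. -/
lemma exists_subseq_weakly_convergent {H : Type*} [NormedAddCommGroup H] [InnerProductSpace ℝ H]
    [CompleteSpace H] [TopologicalSpace.SeparableSpace H] (x : ℕ → H) {M : ℝ}
    (hx : ∀ k, ‖x k‖ ≤ M) : ∃ (v : H) (σ : ℕ → ℕ), StrictMono σ ∧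
      ∀ w : H, Tendsto (fun k => ⟪x (σ k), w⟫_ℝ) atTop (𝓝 ⟪v, w⟫_ℝ) := by
  have hc := WeakDual.isSeqCompact_closedBall ℝ H 0 M
  obtain ⟨a, -, σ, hσ, ha⟩ := hc (x := fun k => StrongDual.toWeakDual
    (InnerProductSpace.toDual ℝ H (x k))) (fun k => by simpa using hx k)
  refine ⟨(InnerProductSpace.toDual ℝ H).symm (WeakDual.toStrongDual a), σ, hσ, fun w => ?_⟩
  have h := ((WeakDual.eval_continuous w).tendsto a).comp ha
  rw [InnerProductSpace.toDual_symm_apply]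
  exact h

end

section

variable {d : ℕ}

/-- A sequence bounded in `L²` of the ball of radius `R + 1` has a subsequence all of whose
mollifications at scales at most `1` converge in `L²` of the ball of radius `R`. Along a weakly
convergent subsequence the mollifications converge pointwise, and they are bounded. -/
lemma exists_subseq_tendsto_mollify (u : ℕ → E d → ℝ) (hu : ∀ k, Continuous (u k)) {R : ℝ}
    {M : NNReal}
    (hM : ∀ k, eLpNorm (u k) 2 (volume.restrict (Metric.closedBall 0 (R + 1))) ≤ M) :
    ∃ σ : ℕ → ℕ, StrictMono σ ∧ ∀ ρ : ContDiffBump (0 : E d), ρ.rOut ≤ 1 →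
      ∃ h : E d → ℝ, AEStronglyMeasurable h (volume.restrict (Metric.closedBall 0 R)) ∧
        Tendsto (fun k => eLpNorm (fun x => mollify ρ (u (σ k)) x - h x) 2
          (volume.restrict (Metric.closedBall 0 R))) atTop (𝓝 0) := by
  set S : Set (E d) := Metric.closedBall 0 (R + 1) with hS
  have hSm : MeasurableSet S := measurableSet_closedBall
  have hmem : ∀ k, MemLp (S.indicator (u k)) 2 volume := fun k =>
    ⟨(hu k).aestronglyMeasurable.indicator hSm, by
      rw [eLpNorm_indicator_eq_eLpNorm_restrict hSm]
      exact (hM k).trans_lt ENNReal.coe_lt_top⟩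
  have hv : ∀ k, ‖(hmem k).toLp‖ ≤ M := fun k => by
    rw [Lp.norm_toLp, eLpNorm_indicator_eq_eLpNorm_restrict hSm]
    exact ENNReal.toReal_le_coe_of_le_coe (hM k)
  -- needed for the separability of `L²`
  have : Fact ((2 : ℝ≥0∞) ≠ ∞) := ⟨by simp⟩
  obtain ⟨v, σ, hσ, hconv⟩ := exists_subseq_weakly_convergent (fun k => (hmem k).toLp) hv
  refine ⟨σ, hσ, fun ρ hρ => ?_⟩
  have hρ2 : MemLp (ρ.normed volume) 2 volume :=
    ρ.continuous_normed.memLp_of_hasCompactSupport ρ.hasCompactSupport_normed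
  have hw : ∀ x : E d, MemLp (fun y => ρ.normed volume (x - y)) 2 volume := fun x =>
    hρ2.comp_measurePreserving (Measure.measurePreserving_sub_left volume x)
  have hwn : ∀ x : E d, ‖(hw x).toLp‖ = (eLpNorm (ρ.normed volume) 2 volume).toReal := fun x => by
    rw [Lp.norm_toLp]
    congr 1
    exact eLpNorm_comp_measurePreserving (g := ρ.normed volume) hρ2.1
      (Measure.measurePreserving_sub_left volume x)
  -- on the ball of radius `R` the mollification only sees the values of `u k` on `S`
  have heq : ∀ k, ∀ x ∈ Metric.closedBall (0 : E d) R,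
      mollify ρ (u k) x = ⟪(hmem k).toLp, (hw x).toLp⟫_ℝ := by
    intro k x hx
    rw [mollify_apply_swap, L2.inner_def]
    refine integral_congr_ae ?_
    filter_upwards [(hmem k).coeFn_toLp, (hw x).coeFn_toLp] with y h1 h2
    rw [h1, h2]
    by_cases hy : y ∈ S
    · simp [Set.indicator_of_mem hy]
    · have h0 : ρ.normed volume (x - y) = 0 := by
        by_contra hne
        have h3 : x - y ∈ Metric.ball (0 : E d) ρ.rOut := by
          rw [← ρ.support_normed_eq (μ := volume)]; exact hne
        rw [mem_ball_zero_iff] at h3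
        rw [mem_closedBall_zero_iff] at hx
        refine hy (mem_closedBall_zero_iff.2 ?_)
        calc ‖y‖ = ‖x - (x - y)‖ := by congr 1; abel
          _ ≤ ‖x‖ + ‖x - y‖ := norm_sub_le _ _
          _ ≤ R + 1 := by linarith
      simp [h0]
  set h : E d → ℝ := fun x => ⟪v, (hw x).toLp⟫_ℝ with hh
  set ν := volume.restrict (Metric.closedBall (0 : E d) R) with hν
  have hmeas : ∀ k, AEStronglyMeasurable (mollify ρ (u k)) ν := fun k =>
    ((ρ.hasCompactSupport_normed.contDiff_convolution_left (n := 0)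
      (ContinuousLinearMap.lsmul ℝ ℝ) ρ.contDiff_normed
      (hu k).locallyIntegrable).continuous).aestronglyMeasurable
  have hae : ∀ᵐ x ∂ν, x ∈ Metric.closedBall (0 : E d) R :=
    ae_restrict_mem measurableSet_closedBall
  have hlim : ∀ᵐ x ∂ν, Tendsto (fun k => mollify ρ (u (σ k)) x) atTop (𝓝 (h x)) := by
    filter_upwards [hae] with x hx
    simp_rw [heq _ x hx]
    exact hconv _
  have hhm : AEStronglyMeasurable h ν := aestronglyMeasurable_of_tendsto_ae atTop
    (fun k => hmeas (σ k)) hlim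
  refine ⟨h, hhm, ?_⟩
  set b : ℝ := (M + ‖v‖) * (eLpNorm (ρ.normed volume) 2 volume).toReal with hb
  have key : Tendsto (fun k => ∫⁻ x, ‖mollify ρ (u (σ k)) x - h x‖ₑ ^ 2 ∂ν) atTop
      (𝓝 (∫⁻ x, 0 ∂ν)) := by
    refine tendsto_lintegral_of_dominated_convergence' (fun _ => ENNReal.ofReal b ^ 2)
      (fun k => ((hmeas (σ k)).sub hhm).enorm.pow_const 2) (fun k => ?_) ?_ ?_
    · filter_upwards [hae] with x hx
      gcongr
      rw [← ofReal_norm]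
      refine ENNReal.ofReal_le_ofReal ?_
      rw [heq _ x hx, hh]
      dsimp only
      rw [← inner_sub_left]
      refine (norm_inner_le_norm _ _).trans ?_
      rw [hwn x, hb]
      gcongr
      exact (norm_sub_le _ _).trans (add_le_add_left (hv _) _)
    · rw [lintegral_const]
      refine ENNReal.mul_ne_top (by simp) ?_
      rw [hν, Measure.restrict_apply_univ]
      exact measure_closedBall_lt_top.ne
    · filter_upwards [hlim] with x hx
      have h1 : Tendsto (fun k => mollify ρ (u (σ k)) x - h x) atTop (𝓝 0) := by
        simpa using hx.sub_const (h x)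
      have h2 := (ENNReal.continuous_pow 2).tendsto 0 |>.comp
        ((continuous_enorm.tendsto (0:ℝ)).comp h1 |>.trans (by simp))
      simpa [Function.comp_def] using h2
  rw [lintegral_zero] at key
  have h2 : ∀ k, eLpNorm (fun x => mollify ρ (u (σ k)) x - h x) 2 ν
      = (∫⁻ x, ‖mollify ρ (u (σ k)) x - h x‖ₑ ^ 2 ∂ν) ^ (1 / 2 : ℝ) := fun k => by
    rw [← eLpNorm_two_sq, ← ENNReal.rpow_natCast, ← ENNReal.rpow_mul]
    norm_num
  simp_rw [h2]
  have h3 := (ENNReal.continuous_rpow_const (y := 1 / 2)).tendsto 0 |>.comp key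
  simpa [Function.comp_def] using h3

/-- Local compactness of bounded sets of the Dirichlet norm: a sequence with bounded gradients that
is bounded in `L²` of a ball has a subsequence that is Cauchy in `L²` of a smaller ball. -/
lemma exists_subseq_cauchy_closedBall (u : ℕ → E d → ℝ) (hu : ∀ k, ContDiff ℝ 1 (u k)) {R : ℝ}
    {M : NNReal} (hgrad : ∀ k, eLpNorm (fderiv ℝ (u k)) 2 volume ≤ M)
    (hM : ∀ k, eLpNorm (u k) 2 (volume.restrict (Metric.closedBall 0 (R + 1))) ≤ M) :
    ∃ σ : ℕ → ℕ, StrictMono σ ∧ ∀ δ : ℝ≥0∞, 0 < δ → ∃ N, ∀ k ≥ N, ∀ l ≥ N,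
      eLpNorm (fun x => u (σ k) x - u (σ l) x) 2 (volume.restrict (Metric.closedBall 0 R)) ≤ δ := by
  obtain ⟨σ, hσ, hconv⟩ := exists_subseq_tendsto_mollify u (fun k => (hu k).continuous) hM
  refine ⟨σ, hσ, fun δ hδ => ?_⟩
  have hδ4 : 0 < δ / 4 := ENNReal.div_pos hδ.ne' (by simp)
  obtain ⟨ε, ⟨hε1, hεM⟩, hε0⟩ : ∃ ε : ℝ, (ε ≤ 1 ∧ ENNReal.ofReal ε * M ≤ δ / 4) ∧ 0 < ε := by
    have h1 : Tendsto (fun ε : ℝ => ENNReal.ofReal ε * M) (𝓝[>] 0) (𝓝 0) := by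
      have : Tendsto (fun ε : ℝ => ENNReal.ofReal ε * M) (𝓝 0) (𝓝 (ENNReal.ofReal 0 * M)) :=
        ENNReal.Tendsto.mul_const (ENNReal.continuous_ofReal.tendsto 0) (by simp)
      simp only [ENNReal.ofReal_zero, zero_mul] at this
      exact this.mono_left nhdsWithin_le_nhds
    have h2 : ∀ᶠ ε : ℝ in 𝓝[>] 0, ε ≤ 1 :=
      mem_nhdsWithin_of_mem_nhds (Iic_mem_nhds zero_lt_one)
    exact ((h2.and (h1.eventually (ge_mem_nhds hδ4))).and self_mem_nhdsWithin).exists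
  let ρ : ContDiffBump (0 : E d) := ⟨ε / 2, ε, by positivity, by linarith⟩
  obtain ⟨h, hhm, hlim⟩ := hconv ρ hε1
  obtain ⟨N, hN⟩ := (hlim.eventually (ge_mem_nhds hδ4)).exists_forall_of_atTop
  set ν := volume.restrict (Metric.closedBall (0 : E d) R) with hν
  have hmeas : ∀ k, AEStronglyMeasurable (mollify ρ (u k)) ν := fun k =>
    ((ρ.hasCompactSupport_normed.contDiff_convolution_left (n := 0)
      (ContinuousLinearMap.lsmul ℝ ℝ) ρ.contDiff_normed
      (hu k).continuous.locallyIntegrable).continuous).aestronglyMeasurable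
  have humeas : ∀ k, AEStronglyMeasurable (u k) ν := fun k =>
    (hu k).continuous.aestronglyMeasurable
  have hmol : ∀ k, eLpNorm (fun x => mollify ρ (u k) x - u k x) 2 ν ≤ δ / 4 := fun k =>
    (eLpNorm_mono_measure _ Measure.restrict_le_self).trans
      ((eLpNorm_mollify_sub_le_fderiv ρ (hu k)).trans
        ((mul_le_mul_right (hgrad k) _).trans hεM))
  have half : ∀ k ≥ N, eLpNorm (fun x => u (σ k) x - h x) 2 ν ≤ δ / 4 + δ / 4 := by
    intro k hk
    have heq : (fun x => u (σ k) x - h x) = (fun x => mollify ρ (u (σ k)) x - h x)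
        - (fun x => mollify ρ (u (σ k)) x - u (σ k) x) := by
      funext x; simp
    rw [heq]
    exact (eLpNorm_sub_le ((hmeas _).sub hhm) ((hmeas _).sub (humeas _)) (by norm_num)).trans
      (add_le_add (hN k hk) (hmol _))
  refine ⟨N, fun k hk l hl => ?_⟩
  have heq : (fun x => u (σ k) x - u (σ l) x) = (fun x => u (σ k) x - h x)
      - (fun x => u (σ l) x - h x) := by
    funext x; simp
  rw [heq]
  refine (eLpNorm_sub_le ((humeas _).sub hhm) ((humeas _).sub hhm) (by norm_num)).trans
    ((add_le_add (half k hk) (half l hl)).trans (le_of_eq ?_))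
  rw [← ENNReal.add_div, ← ENNReal.add_div, ← two_mul, ← two_mul, ← mul_assoc]
  norm_num
  rw [mul_comm, ENNReal.mul_div_cancel_right (by norm_num) (by norm_num)]

end

section

open scoped ContDiff

/-! ### Smooth truncation of the values -/

/-- A smooth approximation of the identity of `ℝ` that vanishes near `0`, is bounded, and does not
increase gradients. -/
lemma exists_smooth_truncation (k : ℕ) : ∃ F : ℝ → ℝ, ContDiff ℝ ∞ F ∧
    (∃ a : ℝ, 0 < a ∧ ∀ t, |t| ≤ a → F t = 0) ∧ (∃ M : ℝ, ∀ t, |F t| ≤ M) ∧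
    (∀ t, ‖deriv F t‖ ≤ 1) ∧ ∀ t : ℝ, |t| ≤ k → |F t - t| ≤ 2 / (k + 1) := by
  have hk : (0:ℝ) < 1 / (k + 1) := by positivity
  let b₁ : ContDiffBump (0:ℝ) := ⟨k + 1, k + 2, by positivity, by linarith⟩
  let b₂ : ContDiffBump (0:ℝ) := ⟨1 / (k + 1) / 2, 1 / (k + 1), by positivity, by linarith⟩
  let h : ℝ → ℝ := fun t => b₁ t * (1 - b₂ t)
  have hsm : ContDiff ℝ ∞ h := b₁.contDiff.mul (contDiff_const.sub b₂.contDiff)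
  have hcont : Continuous h := hsm.continuous
  have hh : Integrable h volume := hcont.integrable_of_hasCompactSupport
    (b₁.hasCompactSupport.mul_right)
  -- `F` is the antiderivative of a smooth `h` with `0 ≤ h ≤ 1` that vanishes near `0` and near
  -- infinity and equals `1` in between
  let F : ℝ → ℝ := fun t => ∫ s in (0:ℝ)..t, h s
  have hF : ∀ t, HasDerivAt F (h t) t := fun t =>
    (hcont.integral_hasStrictDerivAt 0 t).hasDerivAt
  have hderiv : deriv F = h := funext fun t => (hF t).deriv
  have habs : ∀ t s : ℝ, s ∈ Set.uIoc 0 t → |s| ≤ |t| := by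
    intro t s hs
    rcases Set.mem_uIoc.1 hs with ⟨h1, h2⟩ | ⟨h1, h2⟩
    · rw [abs_of_pos h1, abs_of_pos (h1.trans_le h2)]; exact h2
    · rw [abs_of_nonpos h2, abs_of_neg (h1.trans_le h2)]; linarith
  have hbound : ∀ f : ℝ → ℝ, Integrable f volume → ∀ t : ℝ,
      |∫ s in (0:ℝ)..t, f s| ≤ ∫ s, |f s| := by
    intro f hf t
    rw [← Real.norm_eq_abs]
    refine (intervalIntegral.norm_integral_le_integral_norm_uIoc).trans ?_
    exact setIntegral_le_integral hf.norm (Eventually.of_forall fun _ => norm_nonneg _)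
  refine ⟨F, ?_, ⟨1 / (k + 1) / 2, by positivity, fun t ht => ?_⟩, ⟨_, hbound h hh⟩,
    fun t => ?_, fun t ht => ?_⟩
  · rw [contDiff_infty_iff_deriv, hderiv]
    exact ⟨fun t => (hF t).differentiableAt, hsm⟩
  · refine (intervalIntegral.integral_congr_ae (g := fun _ => 0)
      (Eventually.of_forall fun s hs => ?_)).trans (by simp)
    have : b₂ s = 1 := b₂.one_of_mem_closedBall (by
      rw [mem_closedBall_zero_iff]
      exact (habs t s hs).trans ht)
    simp [h, this]
  · rw [hderiv, Real.norm_eq_abs, abs_le]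
    have h1 := b₁.nonneg (x := t); have h2 := b₁.le_one (x := t)
    have h3 := b₂.nonneg (x := t); have h4 := b₂.le_one (x := t)
    constructor <;> simp only [h] <;> nlinarith
  · have e : F t - t = -∫ s in (0:ℝ)..t, b₂ s := by
      have h1 : F t = ∫ s in (0:ℝ)..t, (1 - b₂ s) := by
        refine intervalIntegral.integral_congr_ae (Eventually.of_forall fun s hs => ?_)
        have : b₁ s = 1 := b₁.one_of_mem_closedBall (by
          rw [mem_closedBall_zero_iff]
          exact ((habs t s hs).trans ht).trans (by simp [b₁]))
        simp [h, this]
      rw [h1, intervalIntegral.integral_sub (by simp) (b₂.continuous.intervalIntegrable _ _)]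
      simp
    rw [e, abs_neg]
    refine (hbound _ b₂.integrable t).trans ?_
    simp_rw [abs_of_nonneg b₂.nonneg]
    refine (b₂.integral_le_measure_closedBall volume).trans (le_of_eq ?_)
    rw [Real.volume_real_closedBall (by positivity)]
    simp only [b₂]
    ring

variable {d : ℕ}

/-! ### Gradients of smooth functions -/

lemma norm_gradient (u : E d → ℝ) (x : E d) : ‖gradient u x‖ = ‖fderiv ℝ u x‖ := by
  rw [gradient]; exact LinearIsometryEquiv.norm_map _ _

lemma eLpNorm_gradient (u : E d → ℝ) (q : ℝ≥0∞) (μ : Measure (E d)) :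
    eLpNorm (gradient u) q μ = eLpNorm (fderiv ℝ u) q μ :=
  eLpNorm_congr_norm_ae (Eventually.of_forall fun x => norm_gradient u x)

lemma gradient_apply (u : E d → ℝ) (x : E d) (j : Fin d) :
    gradient u x j = fderiv ℝ u x (EuclideanSpace.single j 1) := by
  rw [← InnerProductSpace.toDual_symm_apply (𝕜 := ℝ) (y := fderiv ℝ u x)]
  rw [EuclideanSpace.inner_single_right]
  simp [gradient]

lemma continuous_gradient {u : E d → ℝ} (hu : ContDiff ℝ 1 u) : Continuous (gradient u) :=
  (LinearIsometryEquiv.continuous _).comp (hu.continuous_fderiv one_ne_zero)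

/-! ### The constraint functional -/

/-- The constraint functional `∑ᵢ ‖φᵢ ψ‖²_{2p}`. -/
noncomputable def constraintFun {n : ℕ} (B : TopologicalSpace.Opens (E d)) (p : ℕ)
    (φ : Fin n → E d → ℝ) (ψ : E d → ℝ) : ℝ≥0∞ := ∑ i, weightedNorm B p (φ i) ψ ^ 2

variable {n : ℕ} {B : TopologicalSpace.Opens (E d)} {p : ℕ} {φ : Fin n → E d → ℝ}

/-- Fatou's lemma for the constraint functional. -/
lemma constraintFun_le_of_tendsto (hmeas : ∀ i, AEMeasurable (φ i) volume)
    {f : ℕ → E d → ℝ} {g : E d → ℝ} (hf : ∀ k, AEStronglyMeasurable (f k) (leb B))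
    (hlim : ∀ᵐ x ∂(leb B), Tendsto (fun k => f k x) atTop (𝓝 (g x)))
    {a : ℕ → ℝ≥0∞} {A : ℝ≥0∞} (ha : ∀ k, constraintFun B p φ (f k) ≤ a k)
    (hA : Tendsto a atTop (𝓝 A)) : constraintFun B p φ g ≤ A := by
  have hφ : ∀ i, AEStronglyMeasurable (φ i) (leb B) := fun i =>
    ((hmeas i).mono_measure Measure.restrict_le_self).aestronglyMeasurable
  have h1 : ∀ i, weightedNorm B p (φ i) g ^ 2
      ≤ liminf (fun k => weightedNorm B p (φ i) (f k) ^ 2) atTop := by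
    intro i
    have h2 : weightedNorm B p (φ i) g ≤ liminf (fun k => weightedNorm B p (φ i) (f k)) atTop :=
      Lp.eLpNorm_lim_le_liminf_eLpNorm (fun k => (hφ i).mul (hf k)) _
        (hlim.mono fun x hx => hx.const_mul _)
    have h3 := Monotone.map_liminf_of_continuousAt (F := atTop)
      (f := fun x : ℝ≥0∞ => x ^ 2) (fun x y h => pow_le_pow_left' h 2)
      (fun k => weightedNorm B p (φ i) (f k)) ((ENNReal.continuous_pow 2).continuousAt)
      (by isBoundedDefault) (by isBoundedDefault)
    calc weightedNorm B p (φ i) g ^ 2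
        ≤ (liminf (fun k => weightedNorm B p (φ i) (f k)) atTop) ^ 2 := by gcongr
      _ = _ := h3
  calc constraintFun B p φ g
      ≤ ∑ i, liminf (fun k => weightedNorm B p (φ i) (f k) ^ 2) atTop :=
        Finset.sum_le_sum fun i _ => h1 i
    _ ≤ liminf (fun k => constraintFun B p φ (f k)) atTop := by
        have := lintegral_liminf_le (u := atTop) (μ := (Measure.count : Measure (Fin n)))
          (f := fun (k : ℕ) i => weightedNorm B p (φ i) (f k) ^ 2) (fun _ => measurable_of_finite _)
        simpa [lintegral_count, tsum_fintype, constraintFun] using this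
    _ ≤ liminf a atTop := liminf_le_liminf (Eventually.of_forall ha)
    _ = A := hA.liminf_eq

lemma weightedNorm_const_mul (f : E d → ℝ) (c : ℝ) (ψ : E d → ℝ) :
    weightedNorm B p f (fun x => c * ψ x) = ‖c‖ₑ * weightedNorm B p f ψ := by
  rw [weightedNorm, weightedNorm, ← eLpNorm_const_smul]
  congr 1
  funext x
  simp only [Pi.smul_apply, smul_eq_mul]
  ring

lemma constraintFun_const_mul (c : ℝ) (ψ : E d → ℝ) :
    constraintFun B p φ (fun x => c * ψ x) = ‖c‖ₑ ^ 2 * constraintFun B p φ ψ := by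
  simp only [constraintFun, weightedNorm_const_mul, mul_pow, Finset.mul_sum]

end

section

open scoped ContDiff

variable {d : ℕ}

/-! ### Mollification of weakly differentiable functions -/

/-- Mollification commutes with the weak gradient. -/
lemma gradient_mollify {ψ : E d → ℝ} {g : E d → E d} (h : HasWeakGradient ⊤ ψ g)
    (ρ : ContDiffBump (0 : E d)) : gradient (mollify ρ ψ) = mollify ρ g := by
  have hψ : LocallyIntegrable ψ volume :=
    locallyIntegrableOn_univ.1 h.locallyIntegrable
  have hg : LocallyIntegrable g volume :=
    locallyIntegrableOn_univ.1 h.locallyIntegrable_grad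
  set η := ρ.normed volume with hη
  have hηs : ContDiff ℝ ∞ η := ρ.contDiff_normed
  have hη1 : ContDiff ℝ 1 η := ρ.contDiff_normed
  have hηc : HasCompactSupport η := ρ.hasCompactSupport_normed
  funext x
  ext j
  rw [gradient_apply]
  have hD := (hηc.hasFDerivAt_convolution_left (ContinuousLinearMap.lsmul ℝ ℝ) hη1 hψ x).fderiv
  change fderiv ℝ (mollify ρ ψ) x = _ at hD
  rw [hD, convolution_def]
  have hex : Integrable (fun t => ((ContinuousLinearMap.lsmul ℝ ℝ : ℝ →L[ℝ] ℝ →L[ℝ] ℝ).precompL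
      (E d) (fderiv ℝ η t)) (ψ (x - t))) volume :=
    ((hηc.fderiv ℝ).convolutionExists_left
      ((ContinuousLinearMap.lsmul ℝ ℝ : ℝ →L[ℝ] ℝ →L[ℝ] ℝ).precompL (E d))
      (hη1.continuous_fderiv one_ne_zero) hψ) x
  rw [ContinuousLinearMap.integral_apply hex]
  simp only [ContinuousLinearMap.precompL_apply, ContinuousLinearMap.lsmul_apply, smul_eq_mul]
  rw [← integral_sub_left_eq_self _ volume x]
  simp only [sub_sub_cancel]
  -- the translated and reflected bump function is the test function
  have hsm : ContDiff ℝ ∞ fun t => η (x - t) := hηs.comp (contDiff_const.sub contDiff_id)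
  have hcs : HasCompactSupport fun t => η (x - t) :=
    hηc.comp_homeomorph (Homeomorph.subLeft x)
  let θ : 𝓓((⊤ : TopologicalSpace.Opens (E d)), ℝ) :=
    ⟨fun t => η (x - t), hsm, hcs, fun _ _ => trivial⟩
  have hθ : ∀ t, fderiv ℝ (θ : E d → ℝ) t (EuclideanSpace.single j 1)
      = -fderiv ℝ η (x - t) (EuclideanSpace.single j 1) := by
    intro t
    have h1 : HasFDerivAt (fun t : E d => x - t) (-ContinuousLinearMap.id ℝ (E d)) t :=
      (hasFDerivAt_id t).const_sub x
    have h2 := ((hη1.differentiable one_ne_zero) (x - t)).hasFDerivAt.comp t h1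
    have h3 : fderiv ℝ (θ : E d → ℝ) t
        = (fderiv ℝ η (x - t)).comp (-ContinuousLinearMap.id ℝ (E d)) := h2.fderiv
    rw [h3]
    simp
  have key := h.integral_eq θ j
  rw [TopologicalSpace.Opens.coe_top, setIntegral_univ, setIntegral_univ] at key
  simp_rw [hθ] at key
  have e1 : ∫ t, fderiv ℝ η (x - t) (EuclideanSpace.single j 1) * ψ t
      = -∫ t, ψ t * -fderiv ℝ η (x - t) (EuclideanSpace.single j 1) := by
    rw [← integral_neg]; congr 1; funext t; ring
  rw [e1, key, neg_neg]
  have e2 : mollify ρ g x j = ∫ t, (η t • g (x - t)) j := by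
    rw [mollify_apply]
    exact ((EuclideanSpace.proj (𝕜 := ℝ) j).integral_comp_comm
      (integrable_normed_smul_translate ρ hg x)).symm
  rw [e2]
  refine Eq.trans ?_ (integral_sub_left_eq_self (fun t => (η t • g (x - t)) j) volume x)
  congr 1
  funext t
  simp only [sub_sub_cancel, PiLp.smul_apply, smul_eq_mul]
  exact mul_comm (g t j) (η (x - t))

lemma contDiff_mollify {ψ : E d → ℝ} (hψ : LocallyIntegrable ψ volume)
    (ρ : ContDiffBump (0 : E d)) : ContDiff ℝ ∞ (mollify ρ ψ) :=
  ρ.hasCompactSupport_normed.contDiff_convolution_left (n := ⊤) (ContinuousLinearMap.lsmul ℝ ℝ)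
    ρ.contDiff_normed hψ

/-- A sequence of bump functions whose supports shrink to the origin. -/
noncomputable def shrinkingBump (d k : ℕ) : ContDiffBump (0 : E d) :=
  ⟨1 / (k + 1) / 2, 1 / (k + 1), by positivity, half_lt_self (by positivity)⟩

lemma ae_tendsto_mollify {ψ : E d → ℝ} (hψ : LocallyIntegrable ψ volume) :
    ∀ᵐ x : E d, Tendsto (fun k => mollify (shrinkingBump d k) ψ x) atTop (𝓝 (ψ x)) := by
  refine ContDiffBump.ae_convolution_tendsto_right_of_locallyIntegrable (K := 2)
    tendsto_one_div_add_atTop_nhds_zero_nat (Eventually.of_forall fun k => ?_) hψ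
  simp only [shrinkingBump]
  linarith

/-- The gradient of a mollification is no larger than the weak gradient. -/
lemma eLpNorm_fderiv_mollify_le {ψ : E d → ℝ} {g : E d → E d} (h : HasWeakGradient ⊤ ψ g)
    (ρ : ContDiffBump (0 : E d)) :
    eLpNorm (fderiv ℝ (mollify ρ ψ)) 2 volume ≤ eLpNorm g 2 volume := by
  have hg : LocallyIntegrable g volume :=
    locallyIntegrableOn_univ.1 h.locallyIntegrable_grad
  rw [← eLpNorm_gradient, gradient_mollify h]
  exact eLpNorm_mollify_le ρ hg.aestronglyMeasurable

/-- Translation by `y` moves a weakly differentiable function by at most `‖y‖ ‖∇ψ‖₂` in `L²`, even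
if the function itself is not square integrable. -/
lemma HasWeakGradient.eLpNorm_translate_sub_le {ψ : E d → ℝ} {g : E d → E d}
    (h : HasWeakGradient ⊤ ψ g) (y : E d) :
    eLpNorm (fun x => ψ (x - y) - ψ x) 2 volume ≤ ‖y‖ₑ * eLpNorm g 2 volume := by
  have hψ : LocallyIntegrable ψ volume :=
    locallyIntegrableOn_univ.1 h.locallyIntegrable
  have hlim := ae_tendsto_mollify hψ
  have hlim' : ∀ᵐ x : E d, Tendsto (fun k => mollify (shrinkingBump d k) ψ (x - y)) atTop
      (𝓝 (ψ (x - y))) :=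
    (measurePreserving_sub_right volume y).quasiMeasurePreserving.ae hlim
  have hc : ∀ k, Continuous (mollify (shrinkingBump d k) ψ) := fun k =>
    (contDiff_mollify hψ _).continuous
  refine (Lp.eLpNorm_lim_le_liminf_eLpNorm (f := fun k x =>
    mollify (shrinkingBump d k) ψ (x - y) - mollify (shrinkingBump d k) ψ x)
    (fun k => (((hc k).comp (continuous_sub_right y)).sub (hc k)).aestronglyMeasurable) _
    ?_).trans ?_
  · filter_upwards [hlim, hlim'] with x h1 h2 using h2.sub h1
  · refine liminf_le_of_frequently_le' (Eventually.frequently (Eventually.of_forall fun k => ?_))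
    refine (IntersectionLocalTime.eLpNorm_translate_sub_le
      ((contDiff_mollify hψ _).of_le (by exact_mod_cast le_top)) y).trans ?_
    gcongr
    exact eLpNorm_fderiv_mollify_le h _

/-- The mollification of a function that vanishes at infinity vanishes at infinity. -/
lemma HasD1Gradient.measure_lt_abs_mollify {ψ : E d → ℝ} {g : E d → E d} (h : HasD1Gradient ψ g)
    (ρ : ContDiffBump (0 : E d)) {a : ℝ} (ha : 0 < a) :
    volume {x : E d | a < |mollify ρ ψ x|} < ⊤ := by
  have hψ : LocallyIntegrable ψ volume :=
    locallyIntegrableOn_univ.1 h.weakGradient.locallyIntegrable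
  have hdiff : eLpNorm (fun x => mollify ρ ψ x - ψ x) 2 volume
      ≤ ENNReal.ofReal ρ.rOut * eLpNorm g 2 volume := by
    refine eLpNorm_mollify_sub_le ρ hψ fun y hy => ?_
    refine (h.weakGradient.eLpNorm_translate_sub_le y).trans ?_
    gcongr
    rw [← ofReal_norm]
    exact ENNReal.ofReal_le_ofReal hy
  have hmem : MemLp (fun x => mollify ρ ψ x - ψ x) 2 volume :=
    ⟨(contDiff_mollify hψ ρ).continuous.aestronglyMeasurable.sub hψ.aestronglyMeasurable,
      hdiff.trans_lt (ENNReal.mul_lt_top ENNReal.ofReal_lt_top h.memLp_grad.2)⟩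
  have h1 : volume {x : E d | a / 2 ≤ ‖mollify ρ ψ x - ψ x‖} < ⊤ := by
    have := hmem.meas_ge_lt_top (by norm_num) (by norm_num) (ε := (a / 2).toNNReal) (by
      simpa using ha)
    refine lt_of_le_of_lt (measure_mono fun x hx => ?_) this
    simp only [Set.mem_ofPred_eq] at hx ⊢
    rw [← NNReal.coe_le_coe, Real.coe_toNNReal _ (by positivity)]
    exact hx
  refine lt_of_le_of_lt (measure_mono fun x hx => ?_)
    (measure_union_lt_top (h.vanish (a / 2) (by positivity)) h1)
  simp only [Set.mem_ofPred_eq, Set.mem_union, Real.norm_eq_abs] at hx ⊢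
  by_contra! hcon
  have := abs_add_le (mollify ρ ψ x - ψ x) (ψ x)
  rw [sub_add_cancel] at this
  linarith

end

section

open scoped ContDiff

variable {d n p : ℕ} {φ : Fin n → E d → ℝ} {c : NNReal}

/-! ### From test functions to the whole domain of the Dirichlet form -/

/-- An inequality `∑ᵢ ‖φᵢ u‖²_{2p} ≤ c ‖∇u‖₂²` extends from test functions to smooth functions in
`H¹(ℝᵈ)`, by means of cutoffs at radius `k`, whose gradients are of order `1 / k`. -/
lemma constraintFun_le_of_contDiff_memLp (hmeas : ∀ i, AEMeasurable (φ i) volume)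
    (hc : ∀ u : 𝓓((⊤ : TopologicalSpace.Opens (E d)), ℝ),
      constraintFun ⊤ p φ u ≤ c * eLpNorm (fderiv ℝ u) 2 volume ^ 2)
    {v : E d → ℝ} (hv : ContDiff ℝ ∞ v) (hv2 : MemLp v 2 volume) :
    constraintFun ⊤ p φ v ≤ c * eLpNorm (fderiv ℝ v) 2 volume ^ 2 := by
  let b : ContDiffBump (0 : E d) := ⟨1, 2, one_pos, one_lt_two⟩
  have hb : ContDiff ℝ ∞ (b : E d → ℝ) := b.contDiff
  have hbd : Continuous (fderiv ℝ (b : E d → ℝ)) := hb.continuous_fderiv (by simp)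
  obtain ⟨C, hC⟩ := hbd.bounded_above_of_compact_support (b.hasCompactSupport.fderiv ℝ)
  have hC0 : 0 ≤ C := (norm_nonneg _).trans (hC 0)
  have hs : ∀ k : ℕ, (0:ℝ) < ((k:ℝ) + 1)⁻¹ := fun k => by positivity
  let χ : ℕ → E d → ℝ := fun k x => b (((k:ℝ) + 1)⁻¹ • x)
  have hχ : ∀ k, ContDiff ℝ ∞ (χ k) := fun k => hb.comp (contDiff_const_smul _)
  have hχ0 : ∀ k x, 0 ≤ χ k x := fun k x => b.nonneg
  have hχ1 : ∀ k x, χ k x ≤ 1 := fun k x => b.le_one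
  have hχd : ∀ k x, ‖fderiv ℝ (χ k) x‖ ≤ C * ((k:ℝ) + 1)⁻¹ := by
    intro k x
    have h1 : HasFDerivAt (fun x : E d => ((k:ℝ) + 1)⁻¹ • x)
      (((k:ℝ) + 1)⁻¹ • ContinuousLinearMap.id ℝ (E d)) x :=
      (((k:ℝ) + 1)⁻¹ • ContinuousLinearMap.id ℝ (E d)).hasFDerivAt
    have h2 := ((hb.differentiable (by simp)) (((k:ℝ) + 1)⁻¹ • x)).hasFDerivAt.comp x h1
    have h3 : fderiv ℝ (χ k) x = (fderiv ℝ (b : E d → ℝ) (((k:ℝ) + 1)⁻¹ • x)).comp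
        (((k:ℝ) + 1)⁻¹ • ContinuousLinearMap.id ℝ (E d)) := h2.fderiv
    rw [h3, ContinuousLinearMap.comp_smul, ContinuousLinearMap.comp_id, norm_smul,
      Real.norm_of_nonneg (hs k).le, mul_comm]
    exact mul_le_mul_of_nonneg_right (hC _) (hs k).le
  let u : ℕ → 𝓓((⊤ : TopologicalSpace.Opens (E d)), ℝ) := fun k =>
    ⟨fun x => χ k x * v x, (hχ k).mul hv, (b.hasCompactSupport.comp_homeomorph
      (Homeomorph.smulOfNeZero (((k:ℝ) + 1)⁻¹) (hs k).ne')).mul_right, fun _ _ => trivial⟩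
  have hu : ∀ k x, u k x = χ k x * v x := fun _ _ => rfl
  have hvc : Continuous (fderiv ℝ v) := hv.continuous_fderiv (by simp)
  have hgrad : ∀ k, eLpNorm (fderiv ℝ (u k)) 2 volume ≤ eLpNorm (fderiv ℝ v) 2 volume
      + ENNReal.ofReal (C * ((k:ℝ) + 1)⁻¹) * eLpNorm v 2 volume := by
    intro k
    set f₁ : E d → ℝ := fun x => ‖fderiv ℝ v x‖ with hf₁
    set f₂ : E d → ℝ := fun x => ‖v x‖ with hf₂
    have hpt : ∀ x, ‖fderiv ℝ (u k) x‖ ≤ ‖(f₁ + (C * ((k:ℝ) + 1)⁻¹) • f₂) x‖ := by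
      intro x
      have h1 : fderiv ℝ (u k) x = χ k x • fderiv ℝ v x + v x • fderiv ℝ (χ k) x :=
        fderiv_fun_mul ((hχ k).differentiable (by simp) x) (hv.differentiable (by simp) x)
      have h0 : (f₁ + (C * ((k:ℝ) + 1)⁻¹) • f₂) x
          = ‖fderiv ℝ v x‖ + C * ((k:ℝ) + 1)⁻¹ * ‖v x‖ := rfl
      rw [h0, h1, Real.norm_of_nonneg (by positivity)]
      refine (norm_add_le _ _).trans (add_le_add ?_ ?_)
      · rw [norm_smul, Real.norm_of_nonneg (hχ0 k x)]
        exact mul_le_of_le_one_left (norm_nonneg _) (hχ1 k x)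
      · rw [norm_smul, mul_comm]
        exact mul_le_mul_of_nonneg_right (hχd k x) (norm_nonneg _)
    have hm₁ : AEStronglyMeasurable f₁ volume := hvc.norm.aestronglyMeasurable
    have hm₂ : AEStronglyMeasurable f₂ volume := hv2.1.norm
    have hn₁ : eLpNorm f₁ 2 volume = eLpNorm (fderiv ℝ v) 2 volume := eLpNorm_norm _
    have hn₂ : eLpNorm f₂ 2 volume = eLpNorm v 2 volume := eLpNorm_norm _
    calc eLpNorm (fderiv ℝ (u k)) 2 volume
        ≤ eLpNorm (f₁ + (C * ((k:ℝ) + 1)⁻¹) • f₂) 2 volume := eLpNorm_mono hpt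
      _ ≤ eLpNorm f₁ 2 volume + eLpNorm ((C * ((k:ℝ) + 1)⁻¹) • f₂) 2 volume :=
        eLpNorm_add_le hm₁ (hm₂.const_smul _) (by norm_num)
      _ = _ := by
        rw [eLpNorm_const_smul, hn₁, hn₂, Real.enorm_of_nonneg (mul_nonneg hC0 (hs k).le)]
  refine constraintFun_le_of_tendsto hmeas (f := fun k => u k)
    (fun k => (u k).continuous.aestronglyMeasurable) (Eventually.of_forall fun x => ?_)
    (a := fun k : ℕ => c * (eLpNorm (fderiv ℝ v) 2 volume
      + ENNReal.ofReal (C * ((k:ℝ) + 1)⁻¹) * eLpNorm v 2 volume) ^ 2) (fun k => ?_) ?_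
  · -- the cutoff equals `1` at `x` as soon as `‖x‖ ≤ k`
    refine tendsto_const_nhds.congr' ?_
    filter_upwards [eventually_ge_atTop ⌈‖x‖⌉₊] with k hk
    have hk' : ‖x‖ ≤ k := (Nat.le_ceil _).trans (by exact_mod_cast hk)
    have : χ k x = 1 := b.one_of_mem_closedBall (by
      rw [mem_closedBall_zero_iff, norm_smul, Real.norm_of_nonneg (hs k).le,
        inv_mul_le_iff₀ (by positivity)]
      change ‖x‖ ≤ (k + 1) * 1
      linarith)
    rw [hu, this, one_mul]
  · refine (hc (u k)).trans ?_
    gcongr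
    exact hgrad k
  · have h1 : Tendsto (fun k : ℕ => C * ((k:ℝ) + 1)⁻¹) atTop (𝓝 0) := by
      simpa [one_div] using tendsto_one_div_add_atTop_nhds_zero_nat.const_mul C
    have h2 : Tendsto (fun k : ℕ => ENNReal.ofReal (C * ((k:ℝ) + 1)⁻¹) * eLpNorm v 2 volume)
        atTop (𝓝 0) := by
      have := ENNReal.Tendsto.mul_const (b := eLpNorm v 2 volume) (ENNReal.tendsto_ofReal h1)
        (Or.inr hv2.2.ne)
      simpa using this
    have h3 : Tendsto (fun k : ℕ => eLpNorm (fderiv ℝ v) 2 volume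
        + ENNReal.ofReal (C * ((k:ℝ) + 1)⁻¹) * eLpNorm v 2 volume) atTop
        (𝓝 (eLpNorm (fderiv ℝ v) 2 volume)) := by
      simpa using h2.const_add (eLpNorm (fderiv ℝ v) 2 volume)
    exact ENNReal.Tendsto.const_mul ((ENNReal.continuous_pow 2).continuousAt.tendsto.comp h3)
      (Or.inr (by simp))

/-- The inequality extends to smooth functions that vanish at infinity, by smooth truncation of
their values: the truncated function is bounded with support of finite measure. -/
lemma constraintFun_le_of_contDiff_vanish (hmeas : ∀ i, AEMeasurable (φ i) volume)
    (hc : ∀ u : 𝓓((⊤ : TopologicalSpace.Opens (E d)), ℝ),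
      constraintFun ⊤ p φ u ≤ c * eLpNorm (fderiv ℝ u) 2 volume ^ 2)
    {v : E d → ℝ} (hv : ContDiff ℝ ∞ v) (hvan : ∀ a : ℝ, 0 < a → volume {x | a < |v x|} < ⊤) :
    constraintFun ⊤ p φ v ≤ c * eLpNorm (fderiv ℝ v) 2 volume ^ 2 := by
  choose F hF hzero hbdd hder happ using exists_smooth_truncation
  have hFv : ∀ k, ContDiff ℝ ∞ (F k ∘ v) := fun k => (hF k).comp hv
  have hgrad : ∀ k, eLpNorm (fderiv ℝ (F k ∘ v)) 2 volume ≤ eLpNorm (fderiv ℝ v) 2 volume := by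
    intro k
    refine eLpNorm_mono fun x => ?_
    have h1 : fderiv ℝ (F k ∘ v) x = deriv (F k) (v x) • fderiv ℝ v x :=
      (((hF k).differentiable (by simp) (v x)).hasDerivAt.comp_hasFDerivAt x
        (hv.differentiable (by simp) x).hasFDerivAt).fderiv
    rw [h1, norm_smul]
    exact mul_le_of_le_one_left (norm_nonneg _) (hder k _)
  have hmem : ∀ k, MemLp (F k ∘ v) 2 volume := by
    intro k
    obtain ⟨a, ha, hFa⟩ := hzero k
    obtain ⟨M, hM⟩ := hbdd k
    have hS : MeasurableSet {x | a < |v x|} :=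
      measurableSet_lt measurable_const hv.continuous.abs.measurable
    have : IsFiniteMeasure (volume.restrict {x | a < |v x|}) := ⟨by simpa using hvan a ha⟩
    have h1 : F k ∘ v = Set.indicator {x | a < |v x|} (F k ∘ v) := by
      refine (Set.indicator_eq_self.2 fun x hx => ?_).symm
      by_contra hcon
      exact hx (hFa _ (not_lt.1 hcon))
    rw [h1, memLp_indicator_iff_restrict hS]
    exact MemLp.of_bound (hFv k).continuous.aestronglyMeasurable M
      (Eventually.of_forall fun x => hM _)
  refine constraintFun_le_of_tendsto hmeas (f := fun k => F k ∘ v)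
    (fun k => (hFv k).continuous.aestronglyMeasurable) (Eventually.of_forall fun x => ?_)
    (a := fun _ => c * eLpNorm (fderiv ℝ v) 2 volume ^ 2) (fun k => ?_) tendsto_const_nhds
  · rw [tendsto_iff_norm_sub_tendsto_zero]
    have h2 : Tendsto (fun k : ℕ => 2 / ((k:ℝ) + 1)) atTop (𝓝 0) := by
      have := tendsto_one_div_add_atTop_nhds_zero_nat.const_mul (2:ℝ)
      simpa [div_eq_mul_inv] using this
    refine squeeze_zero' (Eventually.of_forall fun _ => norm_nonneg _) ?_ h2
    filter_upwards [eventually_ge_atTop ⌈|v x|⌉₊] with k hk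
    exact happ k _ ((Nat.le_ceil _).trans (by exact_mod_cast hk))
  · refine (constraintFun_le_of_contDiff_memLp hmeas hc (hFv k) (hmem k)).trans ?_
    gcongr
    exact hgrad k

/-- An inequality `∑ᵢ ‖φᵢ u‖²_{2p} ≤ c ‖∇u‖₂²` extends from test functions to all of `𝒟(B)`. -/
lemma constraintFun_le_of_hasDGradient (hmeas : ∀ i, AEMeasurable (φ i) volume)
    {B : TopologicalSpace.Opens (E d)}
    (hc : ∀ u : 𝓓(B, ℝ), constraintFun B p φ u ≤ c * eLpNorm (fderiv ℝ u) 2 volume ^ 2)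
    {ψ : E d → ℝ} {g : E d → E d} (h : HasDGradient B ψ g) :
    constraintFun B p φ ψ ≤ c * eLpNorm g 2 (leb B) ^ 2 := by
  rcases h with ⟨-, h⟩ | ⟨rfl, h⟩
  · obtain ⟨η, hη⟩ := h.approx
    have hcont : ∀ k, AEStronglyMeasurable (η k) (leb B) := fun k =>
      (η k).continuous.aestronglyMeasurable
    have hη1 : ∀ k, ContDiff ℝ 1 (η k : E d → ℝ) := fun k => TestFunction.contDiff_one (η k)
    have sq : ∀ {f : ℕ → ℝ≥0∞}, Tendsto (fun k => f k ^ 2) atTop (𝓝 0) →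
        Tendsto f atTop (𝓝 0) := by
      intro f hf
      have := (ENNReal.continuous_rpow_const (y := 1 / 2)).tendsto 0 |>.comp hf
      refine (this.congr fun k => ?_).trans (by simp)
      simp only [Function.comp]
      rw [← ENNReal.rpow_natCast, ← ENNReal.rpow_mul]
      norm_num
    have hval : Tendsto (fun k => eLpNorm (fun x => η k x - ψ x) 2 (leb B)) atTop (𝓝 0) :=
      sq (tendsto_of_tendsto_of_tendsto_of_le_of_le tendsto_const_nhds hη
        (fun _ => zero_le) (fun _ => le_add_self))
    have hgr : Tendsto (fun k => eLpNorm (fun x => gradient (η k) x - g x) 2 (leb B)) atTop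
        (𝓝 0) :=
      sq (tendsto_of_tendsto_of_tendsto_of_le_of_le tendsto_const_nhds hη
        (fun _ => zero_le) (fun _ => le_self_add))
    obtain ⟨ns, hns, hae⟩ := (tendstoInMeasure_of_tendsto_eLpNorm two_ne_zero hcont h.memLp.1
      hval).exists_seq_tendsto_ae
    refine constraintFun_le_of_tendsto hmeas (f := fun k => η (ns k)) (fun k => hcont _) hae
      (a := fun k => c * (eLpNorm g 2 (leb B)
        + eLpNorm (fun x => gradient (η (ns k)) x - g x) 2 (leb B)) ^ 2) (fun k => ?_) ?_
    · refine (hc _).trans ?_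
      gcongr
      rw [← eLpNorm_restrict_eq_of_forall_notMem (s := B) fun x hx =>
        fderiv_of_notMem_tsupport ℝ fun h => hx ((η (ns k)).tsupport_subset h), ← eLpNorm_gradient]
      have e : gradient (η (ns k)) = g + fun x => gradient (η (ns k)) x - g x := by
        funext x; simp
      conv_lhs => rw [e]
      exact eLpNorm_add_le h.memLp_grad.1
        ((continuous_gradient (hη1 _)).aestronglyMeasurable.sub h.memLp_grad.1) (by norm_num)
    · have h3 := (hgr.comp hns.tendsto_atTop).const_add (eLpNorm g 2 (leb B))
      rw [add_zero] at h3
      exact ENNReal.Tendsto.const_mul ((ENNReal.continuous_pow 2).continuousAt.tendsto.comp h3)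
        (Or.inr (by simp))
  · have hψ : LocallyIntegrable ψ volume :=
      locallyIntegrableOn_univ.1 h.weakGradient.locallyIntegrable
    have hleb : leb (⊤ : TopologicalSpace.Opens (E d)) = volume := by simp [leb]
    have hfd : ∀ k, eLpNorm (fderiv ℝ (mollify (shrinkingBump d k) ψ)) 2 volume
        ≤ eLpNorm g 2 volume := fun k => eLpNorm_fderiv_mollify_le h.weakGradient _
    refine constraintFun_le_of_tendsto hmeas (f := fun k => mollify (shrinkingBump d k) ψ)
      (fun k => (contDiff_mollify hψ _).continuous.aestronglyMeasurable)
      (by rw [hleb]; exact ae_tendsto_mollify hψ)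
      (a := fun _ => c * eLpNorm g 2 (leb ⊤) ^ 2) (fun k => ?_) tendsto_const_nhds
    refine (constraintFun_le_of_contDiff_vanish hmeas hc (contDiff_mollify hψ _)
      (fun a ha => h.measure_lt_abs_mollify _ ha)).trans ?_
    rw [hleb]
    gcongr
    exact hfd k

end

section

variable {d : ℕ} {B : TopologicalSpace.Opens (E d)}

/-! ### The domain `𝒟(B)` -/

/-- The product of a locally integrable function on `B` and a continuous function with compact
support in `B` is integrable. -/
lemma integrableOn_mul_of_tsupport_subset {f θ : E d → ℝ}
    (hf : LocallyIntegrableOn f (B : Set (E d)) volume) (hθ : Continuous θ)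
    (hc : HasCompactSupport θ) (hs : tsupport θ ⊆ B) :
    IntegrableOn (fun x => f x * θ x) (B : Set (E d)) volume := by
  have h1 : IntegrableOn (fun x => f x * θ x) (tsupport θ) volume :=
    (hf.integrableOn_compact_subset hs hc).mul_continuousOn hθ.continuousOn hc
  exact h1.of_forall_sdiff_eq_zero B.isOpen.measurableSet fun x hx => by
    rw [image_eq_zero_of_notMem_tsupport hx.2, mul_zero]

lemma TestFunction.integrableOn_mul {f : E d → ℝ}
    (hf : LocallyIntegrableOn f (B : Set (E d)) volume) (η : 𝓓(B, ℝ)) :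
    IntegrableOn (fun x => f x * η x) (B : Set (E d)) volume :=
  integrableOn_mul_of_tsupport_subset hf η.continuous η.hasCompactSupport η.tsupport_subset

lemma TestFunction.tsupport_fderiv_apply_subset (η : 𝓓(B, ℝ)) (v : E d) :
    tsupport (fun x => fderiv ℝ η x v) ⊆ tsupport (η : E d → ℝ) :=
  _root_.tsupport_fderiv_apply_subset ℝ v

lemma TestFunction.contDiff_fderiv_apply (η : 𝓓(B, ℝ)) (v : E d) :
    ContDiff ℝ (⊤ : ℕ∞) fun x => fderiv ℝ η x v :=
  (η.contDiff.fderiv_right (m := (⊤ : ℕ∞)) (by simp)).clm_apply contDiff_const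

lemma TestFunction.integrableOn_mul_fderiv {f : E d → ℝ}
    (hf : LocallyIntegrableOn f (B : Set (E d)) volume) (η : 𝓓(B, ℝ)) (v : E d) :
    IntegrableOn (fun x => f x * fderiv ℝ η x v) (B : Set (E d)) volume :=
  integrableOn_mul_of_tsupport_subset hf (TestFunction.contDiff_fderiv_apply η v).continuous
    (η.hasCompactSupport.fderiv_apply ℝ v)
    ((TestFunction.tsupport_fderiv_apply_subset η v).trans η.tsupport_subset)

/-- The classical gradient of a test function is its weak gradient. -/
lemma TestFunction.hasWeakGradient (η : 𝓓(B, ℝ)) : HasWeakGradient B η (gradient η) where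
  locallyIntegrable := η.continuous.locallyIntegrable.locallyIntegrableOn _
  locallyIntegrable_grad :=
    (continuous_gradient (TestFunction.contDiff_one η)).locallyIntegrable.locallyIntegrableOn _
  integral_eq θ j := by
    have hη1 := TestFunction.contDiff_one η
    have hθ1 := TestFunction.contDiff_one θ
    have hzero : ∀ x ∉ (B : Set (E d)), θ x = 0 := fun x hx =>
      image_eq_zero_of_notMem_tsupport fun h => hx (θ.tsupport_subset h)
    have hzero' : ∀ x ∉ (B : Set (E d)), fderiv ℝ θ x = 0 := fun x hx =>
      fderiv_of_notMem_tsupport ℝ fun h => hx (θ.tsupport_subset h)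
    rw [setIntegral_eq_integral_of_forall_compl_eq_zero fun x hx => by simp [hzero' x hx],
      setIntegral_eq_integral_of_forall_compl_eq_zero fun x hx => by simp [hzero x hx]]
    simp_rw [gradient_apply]
    have c1 : Continuous fun x => fderiv ℝ η x (EuclideanSpace.single j 1) :=
      (TestFunction.contDiff_fderiv_apply η _).continuous
    have c2 : Continuous fun x => fderiv ℝ θ x (EuclideanSpace.single j 1) :=
      (TestFunction.contDiff_fderiv_apply θ _).continuous
    refine integral_mul_fderiv_eq_neg_fderiv_mul_of_integrable ?_ ?_ ?_
      (fun x _ => hη1.differentiable one_ne_zero x) (fun x _ => hθ1.differentiable one_ne_zero x)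
    · exact (c1.mul θ.continuous).integrable_of_hasCompactSupport θ.hasCompactSupport.mul_left
    · exact (η.continuous.mul c2).integrable_of_hasCompactSupport η.hasCompactSupport.mul_right
    · exact (η.continuous.mul θ.continuous).integrable_of_hasCompactSupport
        η.hasCompactSupport.mul_right

lemma locallyIntegrableOn_coord {g : E d → E d}
    (hg : LocallyIntegrableOn g (B : Set (E d)) volume) (j : Fin d) :
    LocallyIntegrableOn (fun x => g x j) (B : Set (E d)) volume := fun x hx => by
  obtain ⟨s, hs, h⟩ := hg x hx
  exact ⟨s, hs, (EuclideanSpace.proj (𝕜 := ℝ) j).integrable_comp h⟩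

lemma HasWeakGradient.linearComb {ψ ψ' : E d → ℝ} {g g' : E d → E d}
    (h : HasWeakGradient B ψ g) (h' : HasWeakGradient B ψ' g') (a b : ℝ) :
    HasWeakGradient B (fun x => a * ψ x + b * ψ' x) (fun x => a • g x + b • g' x) where
  locallyIntegrable := (h.locallyIntegrable.smul a).add (h'.locallyIntegrable.smul b)
  locallyIntegrable_grad := (h.locallyIntegrable_grad.smul a).add (h'.locallyIntegrable_grad.smul b)
  integral_eq θ j := by
    have i1 := TestFunction.integrableOn_mul_fderiv h.locallyIntegrable θ
      (EuclideanSpace.single j 1)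
    have i2 := TestFunction.integrableOn_mul_fderiv h'.locallyIntegrable θ
      (EuclideanSpace.single j 1)
    have i3 := TestFunction.integrableOn_mul
      (locallyIntegrableOn_coord h.locallyIntegrable_grad j) θ
    have i4 := TestFunction.integrableOn_mul
      (locallyIntegrableOn_coord h'.locallyIntegrable_grad j) θ
    simp only [PiLp.add_apply, PiLp.smul_apply, smul_eq_mul, add_mul, mul_assoc]
    rw [integral_add (i1.const_mul a) (i2.const_mul b), integral_add (i3.const_mul a)
      (i4.const_mul b), integral_const_mul, integral_const_mul, integral_const_mul,
      integral_const_mul, h.integral_eq, h'.integral_eq]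
    ring

lemma TestFunction.memLp_gradient (η : 𝓓(B, ℝ)) (q : ℝ≥0∞) : MemLp (gradient η) q volume :=
  (continuous_gradient (TestFunction.contDiff_one η)).memLp_of_hasCompactSupport
    (η.hasCompactSupport.mono' fun x hx => by
      by_contra hcon
      refine hx ?_
      rw [← norm_eq_zero, norm_gradient, fderiv_of_notMem_tsupport ℝ hcon, norm_zero])

lemma TestFunction.gradient_linearComb (η θ : 𝓓(B, ℝ)) (a b : ℝ) (x : E d) :
    gradient (a • η + b • θ : 𝓓(B, ℝ)) x = a • gradient η x + b • gradient θ x := by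
  have h1 := (TestFunction.contDiff_one η).differentiable one_ne_zero x
  have h2 := (TestFunction.contDiff_one θ).differentiable one_ne_zero x
  have e : ((a • η + b • θ : 𝓓(B, ℝ)) : E d → ℝ) = fun x => a * η x + b * θ x := rfl
  rw [e]
  simp only [gradient]
  rw [fderiv_fun_add (h1.const_mul a) (h2.const_mul b), fderiv_const_mul h1, fderiv_const_mul h2,
    map_add]
  congr 1 <;> exact map_smul _ _ _

/-- `𝒟(B)` is stable under multiples and under the addition of test functions. -/
lemma HasDGradient.linearComb {ψ : E d → ℝ} {g : E d → E d} (h : HasDGradient B ψ g)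
    (η : 𝓓(B, ℝ)) (a b : ℝ) :
    HasDGradient B (fun x => a * ψ x + b * η x) (fun x => a • g x + b • gradient η x) := by
  have hηm : MemLp (η : E d → ℝ) 2 volume :=
    η.continuous.memLp_of_hasCompactSupport η.hasCompactSupport
  have hηg := TestFunction.memLp_gradient η 2
  rcases h with ⟨hb, h⟩ | ⟨rfl, h⟩
  · refine Or.inl ⟨hb, h.weakGradient.linearComb (TestFunction.hasWeakGradient η) a b,
      (h.memLp.const_mul a).add ((hηm.restrict _).const_mul b),
      (h.memLp_grad.const_smul a).add ((hηg.restrict _).const_smul b), ?_⟩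
    obtain ⟨θ, hθ⟩ := h.approx
    refine ⟨fun k => a • θ k + b • η, ?_⟩
    have e1 : ∀ k, eLpNorm (fun x => gradient (a • θ k + b • η : 𝓓(B, ℝ)) x
        - (a • g x + b • gradient η x)) 2 (leb B)
        = ‖a‖ₑ * eLpNorm (fun x => gradient (θ k) x - g x) 2 (leb B) := by
      intro k
      rw [← eLpNorm_const_smul]
      congr 1
      funext x
      rw [TestFunction.gradient_linearComb, Pi.smul_apply, smul_sub]
      abel
    have e2 : ∀ k, eLpNorm (fun x => (a • θ k + b • η : 𝓓(B, ℝ)) x - (a * ψ x + b * η x)) 2 (leb B)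
        = ‖a‖ₑ * eLpNorm (fun x => θ k x - ψ x) 2 (leb B) := by
      intro k
      rw [← eLpNorm_const_smul]
      congr 1
      funext x
      have : (a • θ k + b • η : 𝓓(B, ℝ)) x = a * θ k x + b * η x := rfl
      rw [this, Pi.smul_apply, smul_eq_mul]
      ring
    simp_rw [e1, e2, mul_pow, ← mul_add]
    have := ENNReal.Tendsto.const_mul (a := ‖a‖ₑ ^ 2) hθ (Or.inr (by simp))
    simpa using this
  · refine Or.inr ⟨rfl, h.weakGradient.linearComb (TestFunction.hasWeakGradient η) a b,
      fun s hs => ?_, (h.memLp_grad.const_smul a).add (hηg.const_smul b)⟩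
    have hpos : 0 < |a| + 1 := by positivity
    refine lt_of_le_of_lt (measure_mono fun x hx => ?_)
      (measure_union_lt_top (h.vanish (s / (|a| + 1)) (by positivity))
        η.hasCompactSupport.measure_lt_top)
    by_cases hxη : x ∈ tsupport (η : E d → ℝ)
    · exact Or.inr hxη
    · left
      simp only [Set.mem_ofPred_eq] at hx ⊢
      rw [image_eq_zero_of_notMem_tsupport hxη, mul_zero, add_zero, abs_mul] at hx
      rw [div_lt_iff₀ hpos]
      nlinarith [abs_nonneg (ψ x)]

/-- Convergence in `L^q` implies convergence of the integrals against a continuous function with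
compact support. -/
lemma tendsto_integral_mul_of_tendsto_eLpNorm {q : ℝ≥0∞} (hq : 1 ≤ q) {f : ℕ → E d → ℝ}
    {g θ : E d → ℝ} (hf : ∀ k, MemLp (f k) q volume) (hg : MemLp g q volume)
    (hlim : Tendsto (fun k => eLpNorm (fun x => f k x - g x) q volume) atTop (𝓝 0))
    (hθ : Continuous θ) (hc : HasCompactSupport θ) :
    Tendsto (fun k => ∫ x, f k x * θ x) atTop (𝓝 (∫ x, g x * θ x)) := by
  obtain ⟨C, hC⟩ := hθ.bounded_above_of_compact_support hc
  have hint : ∀ f : E d → ℝ, MemLp f q volume → Integrable (fun x => f x * θ x) volume := by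
    intro f hf
    have := integrableOn_mul_of_tsupport_subset (B := ⊤)
      ((hf.locallyIntegrable hq).locallyIntegrableOn _) hθ hc fun _ _ => trivial
    rwa [TopologicalSpace.Opens.coe_top, integrableOn_univ] at this
  refine tendsto_integral_of_L1 _ (hint g hg).1 (Eventually.of_forall fun k => hint _ (hf k)) ?_
  set K := tsupport θ with hK
  have hfin : volume K ≠ ⊤ := hc.measure_lt_top.ne
  have hb : ∀ k, ∫⁻ x, ‖f k x * θ x - g x * θ x‖ₑ ≤ ENNReal.ofReal C *
      (eLpNorm (fun x => f k x - g x) q volume *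
        volume K ^ (1 / (1 : ℝ≥0∞).toReal - 1 / q.toReal)) := by
    intro k
    calc ∫⁻ x, ‖f k x * θ x - g x * θ x‖ₑ
        = ∫⁻ x in K, ‖f k x * θ x - g x * θ x‖ₑ := by
          refine (setLIntegral_eq_of_support_subset fun x hx => ?_).symm
          by_contra hxK
          refine hx ?_
          simp [image_eq_zero_of_notMem_tsupport hxK]
      _ ≤ ∫⁻ x in K, ENNReal.ofReal C * ‖f k x - g x‖ₑ := by
          refine lintegral_mono fun x => ?_
          rw [← sub_mul, enorm_mul, mul_comm]
          gcongr
          rw [← ofReal_norm]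
          exact ENNReal.ofReal_le_ofReal (hC x)
      _ = ENNReal.ofReal C * eLpNorm (fun x => f k x - g x) 1 (volume.restrict K) := by
          rw [lintegral_const_mul' _ _ ENNReal.ofReal_ne_top, eLpNorm_one_eq_lintegral_enorm]
      _ ≤ _ := by
          gcongr
          refine (eLpNorm_le_eLpNorm_mul_rpow_measure_univ hq
            ((hf k).sub hg).1.restrict).trans ?_
          rw [Measure.restrict_apply_univ]
          gcongr
          exact eLpNorm_mono_measure _ Measure.restrict_le_self
  refine tendsto_of_tendsto_of_tendsto_of_le_of_le tendsto_const_nhds ?_ (fun _ => zero_le) hb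
  have hexp : 0 ≤ 1 / (1 : ℝ≥0∞).toReal - 1 / q.toReal := by
    rw [ENNReal.toReal_one, div_one, sub_nonneg]
    rcases eq_or_ne q ⊤ with rfl | hq'
    · simp
    · rw [div_le_one (ENNReal.toReal_pos (zero_lt_one.trans_le hq).ne' hq')]
      simpa using ENNReal.toReal_mono hq' hq
  have h1 := ENNReal.Tendsto.mul_const hlim
    (b := volume K ^ (1 / (1 : ℝ≥0∞).toReal - 1 / q.toReal))
    (Or.inr (ENNReal.rpow_ne_top_of_nonneg hexp hfin))
  have h2 := ENNReal.Tendsto.const_mul (a := ENNReal.ofReal C) h1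
    (Or.inr ENNReal.ofReal_ne_top)
  simpa using h2

/-- A limit of test functions in `L^r`, `2 ≤ r < ∞`, with gradients converging in `L²`, lies in
`𝒟(B)`. -/
lemma hasDGradient_of_tendsto (hB : Bornology.IsBounded (B : Set (E d)) ∨ B = ⊤) {r : NNReal}
    (hr : 2 ≤ r) {u : ℕ → 𝓓(B, ℝ)} {ψ : E d → ℝ} {g : E d → E d} (hψ : MemLp ψ r volume)
    (hg : MemLp g 2 volume)
    (hlim : Tendsto (fun k => eLpNorm (fun x => u k x - ψ x) r volume) atTop (𝓝 0))
    (hlimg : Tendsto (fun k => eLpNorm (fun x => gradient (u k) x - g x) 2 volume) atTop (𝓝 0)) :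
    HasDGradient B ψ g := by
  have hr2 : (2 : ℝ≥0∞) ≤ r := by exact_mod_cast hr
  have hr1 : (1 : ℝ≥0∞) ≤ r := le_trans (by norm_num) hr2
  have hur : ∀ k, MemLp (u k : E d → ℝ) r volume := fun k =>
    (u k).continuous.memLp_of_hasCompactSupport (u k).hasCompactSupport
  have hcoord : ∀ (f : E d → E d) (j : Fin d), MemLp f 2 volume →
      MemLp (fun x => f x j) 2 volume := fun f j hf =>
    (EuclideanSpace.proj (𝕜 := ℝ) j).comp_memLp' hf
  have hweak : HasWeakGradient B ψ g := by
    refine ⟨(hψ.locallyIntegrable hr1).locallyIntegrableOn _,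
      (hg.locallyIntegrable (by norm_num)).locallyIntegrableOn _, fun θ j => ?_⟩
    have hzero : ∀ x ∉ (B : Set (E d)), θ x = 0 := fun x hx =>
      image_eq_zero_of_notMem_tsupport fun h => hx (θ.tsupport_subset h)
    have hzero' : ∀ x ∉ (B : Set (E d)), fderiv ℝ θ x = 0 := fun x hx =>
      fderiv_of_notMem_tsupport ℝ fun h => hx (θ.tsupport_subset h)
    have e1 : ∀ f : E d → ℝ, ∫ x in (B : Set (E d)), f x * fderiv ℝ θ x (EuclideanSpace.single j 1)
        = ∫ x, f x * fderiv ℝ θ x (EuclideanSpace.single j 1) := fun f =>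
      setIntegral_eq_integral_of_forall_compl_eq_zero fun x hx => by simp [hzero' x hx]
    have e2 : ∀ f : E d → E d, ∫ x in (B : Set (E d)), f x j * θ x = ∫ x, f x j * θ x := fun f =>
      setIntegral_eq_integral_of_forall_compl_eq_zero fun x hx => by simp [hzero x hx]
    have l1 := tendsto_integral_mul_of_tendsto_eLpNorm hr1 hur hψ hlim
      (TestFunction.contDiff_fderiv_apply θ (EuclideanSpace.single j 1)).continuous
      (θ.hasCompactSupport.fderiv_apply ℝ _)
    have l2 := tendsto_integral_mul_of_tendsto_eLpNorm (q := 2) (by norm_num)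
      (f := fun k x => gradient (u k) x j) (g := fun x => g x j)
      (fun k => hcoord _ j (TestFunction.memLp_gradient (u k) 2)) (hcoord g j hg)
      (tendsto_of_tendsto_of_tendsto_of_le_of_le tendsto_const_nhds hlimg (fun _ => zero_le)
        fun k => eLpNorm_mono fun x => PiLp.norm_apply_le (gradient (u k) x - g x) j)
      θ.continuous θ.hasCompactSupport
    rw [e1, e2]
    refine tendsto_nhds_unique l1 (l2.neg.congr fun k => ?_)
    have := (TestFunction.hasWeakGradient (u k)).integral_eq θ j
    rw [e1, e2] at this
    exact this.symm
  rcases hB with hb | hB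
  · have hfinB : volume (B : Set (E d)) ≠ ⊤ := hb.measure_lt_top.ne
    have : IsFiniteMeasure (leb B) := ⟨by simpa [leb] using hfinB.lt_top⟩
    refine Or.inl ⟨hb, hweak, (hψ.restrict _).mono_exponent hr2, hg.restrict _, u, ?_⟩
    set c := volume (B : Set (E d)) ^ (1 / (2 : ℝ≥0∞).toReal - 1 / (r : ℝ≥0∞).toReal) with hc
    have hct : c ≠ ⊤ := by
      refine ENNReal.rpow_ne_top_of_nonneg ?_ hfinB
      have h2r : (2:ℝ) ≤ r := by exact_mod_cast hr
      simp only [ENNReal.toReal_ofNat, ENNReal.coe_toReal, sub_nonneg]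
      exact one_div_le_one_div_of_le two_pos h2r
    have l1 : Tendsto (fun k => eLpNorm (fun x => gradient (u k) x - g x) 2 (leb B)) atTop (𝓝 0) :=
      tendsto_of_tendsto_of_tendsto_of_le_of_le tendsto_const_nhds hlimg (fun _ => zero_le)
        fun k => eLpNorm_mono_measure _ Measure.restrict_le_self
    have l2 : Tendsto (fun k => eLpNorm (fun x => u k x - ψ x) 2 (leb B)) atTop (𝓝 0) := by
      have h1 := ENNReal.Tendsto.mul_const (b := c) hlim (Or.inr hct)
      rw [zero_mul] at h1
      refine tendsto_of_tendsto_of_tendsto_of_le_of_le tendsto_const_nhds h1 (fun _ => zero_le)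
        fun k => ?_
      refine (eLpNorm_le_eLpNorm_mul_rpow_measure_univ hr2
        ((hur k).sub hψ).1.restrict).trans ?_
      rw [Measure.restrict_apply_univ]
      gcongr
      exact eLpNorm_mono_measure _ Measure.restrict_le_self
    have h3 := ((ENNReal.continuous_pow 2).continuousAt.tendsto.comp l1).add
      ((ENNReal.continuous_pow 2).continuousAt.tendsto.comp l2)
    simpa [Function.comp_def] using h3
  · refine Or.inr ⟨hB, hB ▸ hweak, fun a ha => ?_, hg⟩
    have h0 : (r : ℝ≥0∞) ≠ 0 := (zero_lt_one.trans_le hr1).ne'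
    have := hψ.meas_ge_lt_top h0 ENNReal.coe_ne_top (ε := a.toNNReal) (by simpa using ha)
    refine lt_of_le_of_lt (measure_mono fun x hx => ?_) this
    simp only [Set.mem_ofPred_eq] at hx ⊢
    rw [← NNReal.coe_le_coe, Real.coe_toNNReal _ ha.le]
    exact hx.le

end

section

variable {d n p : ℕ} {B : TopologicalSpace.Opens (E d)} {φ : Fin n → E d → ℝ}

/-! ### Weighted norms of test functions -/

lemma exists_weightedNorm_le_eLpNorm_closedBall (hnonneg : ∀ i x, 0 ≤ φ i x)
    (hbdd : ∀ i, ∃ M : ℝ, ∀ x, φ i x ≤ M) (hcomp : ∀ i, HasCompactSupport (φ i)) :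
    ∃ (R : ℝ) (M : NNReal), ∀ i (f : E d → ℝ), weightedNorm B p (φ i) f
      ≤ M * eLpNorm f ((2 * p : ℕ) : ℝ≥0∞) (volume.restrict (Metric.closedBall 0 R)) := by
  choose m hm using hbdd
  obtain ⟨R, hR⟩ := (Bornology.isBounded_iUnion.2 fun i =>
    (hcomp i).isCompact.isBounded).subset_closedBall (0 : E d)
  refine ⟨R, ∑ i, (m i).toNNReal, fun i f => ?_⟩
  have hMi : m i ≤ (∑ i, (m i).toNNReal : NNReal) := by
    refine (Real.le_coe_toNNReal _).trans (NNReal.coe_le_coe.2 ?_)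
    exact Finset.single_le_sum (f := fun i => (m i).toNNReal) (fun _ _ => zero_le)
      (Finset.mem_univ i)
  set M : NNReal := ∑ i, (m i).toNNReal
  have hzero : ∀ x ∉ Metric.closedBall (0 : E d) R, φ i x * f x = 0 := fun x hx => by
    rw [image_eq_zero_of_notMem_tsupport fun h => hx (hR (Set.mem_iUnion_of_mem i h)), zero_mul]
  calc weightedNorm B p (φ i) f
      ≤ eLpNorm (fun x => φ i x * f x) ((2 * p : ℕ) : ℝ≥0∞) volume :=
        eLpNorm_mono_measure _ Measure.restrict_le_self
    _ = eLpNorm (fun x => φ i x * f x) ((2 * p : ℕ) : ℝ≥0∞)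
        (volume.restrict (Metric.closedBall 0 R)) :=
        (eLpNorm_restrict_eq_of_forall_notMem hzero).symm
    _ ≤ eLpNorm ((M : ℝ) • f) ((2 * p : ℕ) : ℝ≥0∞) (volume.restrict (Metric.closedBall 0 R)) := by
        refine eLpNorm_mono fun x => ?_
        rw [Pi.smul_apply, norm_mul, norm_smul]
        refine mul_le_mul_of_nonneg_right ?_ (norm_nonneg _)
        rw [Real.norm_of_nonneg (hnonneg i x), Real.norm_of_nonneg M.coe_nonneg]
        exact (hm i x).trans hMi
    _ = _ := by
        rw [eLpNorm_const_smul]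
        congr 1
        rw [Real.enorm_of_nonneg M.coe_nonneg, ENNReal.ofReal_coe_nnreal]

/-- On balls, `L^r` controls `L^s` for `s ≤ r`. -/
lemma exists_eLpNorm_closedBall_le {s : ℕ} {r : NNReal} (hs : 1 ≤ s) (hsr : (s:ℝ) ≤ r) (R : ℝ) :
    ∃ K : NNReal, ∀ f : E d → ℝ, AEStronglyMeasurable f volume →
      eLpNorm f (s : ℝ≥0∞) (volume.restrict (Metric.closedBall 0 R)) ≤ K * eLpNorm f r volume := by
  have hexp : 0 ≤ 1 / (s : ℝ≥0∞).toReal - 1 / (r : ℝ≥0∞).toReal := by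
    simp only [ENNReal.toReal_natCast, ENNReal.coe_toReal, sub_nonneg]
    exact one_div_le_one_div_of_le (by exact_mod_cast hs) hsr
  have hfin : volume (Metric.closedBall (0 : E d) R) ^
      (1 / (s : ℝ≥0∞).toReal - 1 / (r : ℝ≥0∞).toReal) ≠ ⊤ :=
    ENNReal.rpow_ne_top_of_nonneg hexp measure_closedBall_lt_top.ne
  refine ⟨(volume (Metric.closedBall (0 : E d) R) ^
      (1 / (s : ℝ≥0∞).toReal - 1 / (r : ℝ≥0∞).toReal)).toNNReal, fun f hf => ?_⟩
  rw [ENNReal.coe_toNNReal hfin, mul_comm]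
  have hle : (s : ℝ≥0∞) ≤ r := by
    have : (s : NNReal) ≤ r := by exact_mod_cast hsr
    exact_mod_cast this
  refine (eLpNorm_le_eLpNorm_mul_rpow_measure_univ hle hf.restrict).trans ?_
  rw [Measure.restrict_apply_univ]
  gcongr
  exact Measure.restrict_le_self

lemma weightedNorm_add_le (hp : 1 ≤ p) {f ψ ψ' : E d → ℝ} (hf : AEMeasurable f volume)
    (hψ : AEStronglyMeasurable ψ (leb B)) (hψ' : AEStronglyMeasurable ψ' (leb B)) :
    weightedNorm B p f (fun x => ψ x + ψ' x) ≤ weightedNorm B p f ψ + weightedNorm B p f ψ' := by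
  have hf' : AEStronglyMeasurable f (leb B) :=
    (hf.mono_measure Measure.restrict_le_self).aestronglyMeasurable
  have e : (fun x => f x * (ψ x + ψ' x)) = (fun x => f x * ψ x) + fun x => f x * ψ' x := by
    funext x; simp [mul_add]
  rw [weightedNorm, e]
  refine eLpNorm_add_le (hf'.mul hψ) (hf'.mul hψ') ?_
  have : 1 ≤ 2 * p := by omega
  exact_mod_cast this

lemma TestFunction.linearComb_apply (η θ : 𝓓(B, ℝ)) (a b : ℝ) (x : E d) :
    (a • η + b • θ : 𝓓(B, ℝ)) x = a * η x + b * θ x := rfl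

lemma TestFunction.memLp (η : 𝓓(B, ℝ)) (q : ℝ≥0∞) : MemLp (η : E d → ℝ) q volume :=
  η.continuous.memLp_of_hasCompactSupport η.hasCompactSupport

/-- The gradient of a test function on `B`, as an element of `L²(ℝᵈ)`; it vanishes off `B`. -/
noncomputable def gradLp (η : 𝓓(B, ℝ)) : Lp (E d) 2 (volume : Measure (E d)) :=
  (TestFunction.memLp_gradient η 2).toLp

lemma norm_gradLp (η : 𝓓(B, ℝ)) : ‖gradLp η‖ = (eLpNorm (fderiv ℝ η) 2 volume).toReal := by
  rw [gradLp, Lp.norm_toLp, eLpNorm_gradient]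

lemma eLpNorm_fderiv_eq (η : 𝓓(B, ℝ)) :
    eLpNorm (fderiv ℝ η) 2 volume = ENNReal.ofReal ‖gradLp η‖ := by
  rw [norm_gradLp, ENNReal.ofReal_toReal]
  rw [← eLpNorm_gradient]
  exact (TestFunction.memLp_gradient η 2).2.ne

lemma gradLp_linearComb (η θ : 𝓓(B, ℝ)) (a b : ℝ) :
    gradLp (a • η + b • θ) = a • gradLp η + b • gradLp θ := by
  rw [gradLp, gradLp, gradLp, ← MemLp.toLp_const_smul, ← MemLp.toLp_const_smul, ← MemLp.toLp_add]
  congr 1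
  funext x
  exact TestFunction.gradient_linearComb η θ a b x

/-- Bounded sequences of test functions have subsequences that are Cauchy for all the weighted
norms: the exponent `2p` lies between `2`, where compactness holds, and `r`, where the Sobolev
inequality gives boundedness. -/
lemma exists_subseq_weightedNorm_cauchy (hp : 1 ≤ p) {r C : NNReal} (hr : 2 * (p : ℝ) < r)
    (hS : ∀ u : 𝓓(B, ℝ), eLpNorm u r volume ≤ C * eLpNorm (fderiv ℝ u) 2 volume)
    (hnonneg : ∀ i x, 0 ≤ φ i x) (hbdd : ∀ i, ∃ M : ℝ, ∀ x, φ i x ≤ M)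
    (hcomp : ∀ i, HasCompactSupport (φ i)) (u : ℕ → 𝓓(B, ℝ))
    (hu : ∀ k, eLpNorm (fderiv ℝ (u k)) 2 volume ≤ 1) :
    ∃ σ : ℕ → ℕ, StrictMono σ ∧ ∀ δ : ℝ≥0∞, 0 < δ → ∃ N, ∀ k ≥ N, ∀ l ≥ N, ∀ i,
      weightedNorm B p (φ i) (fun x => u (σ k) x - u (σ l) x) ≤ δ := by
  have hp' : (1:ℝ) ≤ p := by exact_mod_cast hp
  obtain ⟨R, M, hM⟩ := exists_weightedNorm_le_eLpNorm_closedBall (B := B) (p := p) hnonneg hbdd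
    hcomp
  obtain ⟨K, hK⟩ := exists_eLpNorm_closedBall_le (d := d) (s := 2) (r := r) (by norm_num)
    (by push_cast; linarith) (R + 1)
  obtain ⟨a, b, ha, hb, hint⟩ := exists_eLpNorm_le_interpolation (q := 2 * p) (r := r) (by omega)
    (by push_cast; exact hr)
  have hur : ∀ k, eLpNorm (u k) r volume ≤ C := fun k =>
    (hS (u k)).trans ((mul_le_mul_right (hu k) _).trans (by simp))
  obtain ⟨σ, hσ, hcau⟩ := exists_subseq_cauchy_closedBall (fun k => (u k : E d → ℝ))
    (fun k => TestFunction.contDiff_one (u k)) (R := R) (M := 1 + K * C)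
    (fun k => (hu k).trans (by simp))
    (fun k => (hK _ (u k).continuous.aestronglyMeasurable).trans
      ((mul_le_mul_right (hur k) _).trans (by simp)))
  refine ⟨σ, hσ, fun δ hδ => ?_⟩
  have hlim : Tendsto (fun x : ℝ≥0∞ => M * (x ^ a * ((C:ℝ≥0∞) + C) ^ b)) (𝓝 0) (𝓝 0) := by
    have h1 := (ENNReal.continuous_rpow_const (y := a)).tendsto 0
    have h2 := ENNReal.Tendsto.const_mul (a := (M:ℝ≥0∞)) (ENNReal.Tendsto.mul_const
      (b := ((C:ℝ≥0∞) + C) ^ b) h1 (Or.inr (ENNReal.rpow_ne_top_of_nonneg hb (by simp))))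
      (Or.inr (by simp))
    simpa [ENNReal.zero_rpow_of_pos ha] using h2
  obtain ⟨δ', hδ', hpos⟩ : ∃ x : ℝ≥0∞, M * (x ^ a * ((C:ℝ≥0∞) + C) ^ b) ≤ δ ∧ 0 < x :=
    (((hlim.mono_left nhdsWithin_le_nhds).eventually (ge_mem_nhds hδ)).and
      (self_mem_nhdsWithin (s := Set.Ioi (0:ℝ≥0∞)))).exists
  obtain ⟨N, hN⟩ := hcau δ' hpos
  refine ⟨N, fun k hk l hl i => (hM i _).trans (le_trans ?_ hδ')⟩
  have hsub : AEStronglyMeasurable (fun x => u (σ k) x - u (σ l) x) volume :=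
    ((u (σ k)).continuous.sub (u (σ l)).continuous).aestronglyMeasurable
  gcongr
  refine (hint _ _ hsub.restrict).trans ?_
  gcongr
  · exact hN k hk l hl
  · refine (eLpNorm_mono_measure _ Measure.restrict_le_self).trans ((eLpNorm_sub_le
      (u (σ k)).continuous.aestronglyMeasurable (u (σ l)).continuous.aestronglyMeasurable ?_).trans
      (add_le_add (hur _) (hur _)))
    have : (1 : NNReal) ≤ r := by
      rw [← NNReal.coe_le_coe]; push_cast; linarith
    exact_mod_cast this

lemma exists_weightedNorm_le_eLpNorm (hp : 1 ≤ p) {r : NNReal} (hr : 2 * (p : ℝ) < r)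
    (hnonneg : ∀ i x, 0 ≤ φ i x) (hbdd : ∀ i, ∃ M : ℝ, ∀ x, φ i x ≤ M)
    (hcomp : ∀ i, HasCompactSupport (φ i)) :
    ∃ K : NNReal, ∀ i (f : E d → ℝ), AEStronglyMeasurable f volume →
      weightedNorm B p (φ i) f ≤ K * eLpNorm f r volume := by
  obtain ⟨R, M, hM⟩ := exists_weightedNorm_le_eLpNorm_closedBall (B := B) (p := p) hnonneg hbdd
    hcomp
  obtain ⟨K, hK⟩ := exists_eLpNorm_closedBall_le (d := d) (s := 2 * p) (r := r) (by omega)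
    (by push_cast; exact hr.le) R
  refine ⟨M * K, fun i f hf => (hM i f).trans ?_⟩
  rw [ENNReal.coe_mul, mul_assoc]
  gcongr
  exact hK f hf

/-- If the constraint functional vanishes on all test functions, then all weights vanish. -/
lemma ae_eq_zero_of_constraintFun_eq_zero (hp : 1 ≤ p) (hmeas : ∀ i, AEMeasurable (φ i) volume)
    (hnonneg : ∀ i x, 0 ≤ φ i x) (hbdd : ∀ i, ∃ M : ℝ, ∀ x, φ i x ≤ M)
    (hsupp : ∀ i, tsupport (φ i) ⊆ (B : Set (E d)))
    (h : ∀ u : 𝓓(B, ℝ), constraintFun B p φ u = 0) (i : Fin n) : φ i =ᵐ[volume] 0 := by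
  obtain ⟨M, hM⟩ := hbdd i
  have hloc : LocallyIntegrable (φ i) volume := by
    refine (locallyIntegrable_const M).mono (hmeas i).aestronglyMeasurable
      (Eventually.of_forall fun x => ?_)
    rw [Real.norm_of_nonneg (hnonneg i x)]
    exact (hM x).trans (le_abs_self M)
  have key := B.isOpen.ae_eq_zero_of_integral_contDiff_smul_eq_zero
    (hloc.locallyIntegrableOn _) fun η hη hc hs => by
      have h0 : weightedNorm B p (φ i) (⟨η, hη, hc, hs⟩ : 𝓓(B, ℝ)) = 0 := by
        have h1 := (Finset.sum_eq_zero_iff.1 (h ⟨η, hη, hc, hs⟩)) i (Finset.mem_univ i)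
        exact pow_eq_zero_iff two_ne_zero |>.1 h1
      have hp0 : ((2 * p : ℕ) : ℝ≥0∞) ≠ 0 := by
        have : 2 * p ≠ 0 := by omega
        exact_mod_cast this
      have h1 : (fun x => φ i x * η x) =ᵐ[leb B] 0 :=
        (eLpNorm_eq_zero_iff (((hmeas i).mono_measure
          Measure.restrict_le_self).aestronglyMeasurable.mul
            hη.continuous.aestronglyMeasurable) hp0).1 h0
      rw [← setIntegral_eq_integral_of_forall_compl_eq_zero (s := B) fun x hx => by
        rw [image_eq_zero_of_notMem_tsupport fun h => hx (hs h), zero_smul]]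
      refine integral_eq_zero_of_ae (h1.mono fun x hx => ?_)
      exact (mul_comm _ _).trans hx
  filter_upwards [key] with x hx
  by_cases hxB : x ∈ B
  · exact hx hxB
  · exact image_eq_zero_of_notMem_tsupport fun h => hxB (hsupp i h)

end

section

variable {d n p : ℕ} {B : TopologicalSpace.Opens (E d)} {φ : Fin n → E d → ℝ}

/-! ### Existence of an optimal function -/

lemma constraintFun_le_of_forall_weightedNorm_le {ψ : E d → ℝ} {A : ℝ≥0∞}
    (h : ∀ i, weightedNorm B p (φ i) ψ ≤ A) : constraintFun B p φ ψ ≤ n * A ^ 2 := by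
  calc constraintFun B p φ ψ ≤ ∑ _i : Fin n, A ^ 2 :=
        Finset.sum_le_sum fun i _ => pow_le_pow_left' (h i) 2
    _ = n * A ^ 2 := by simp

/-- The best constant in the inequality `∑ᵢ ‖φᵢ u‖²_{2p} ≤ Λ ‖∇u‖₂²` for test functions is finite
and positive, and it is approached by a sequence of test functions in the unit ball of the Dirichlet
norm. -/
lemma exists_best_constant (hp : 1 ≤ p) {K : NNReal}
    (hK : ∀ i (u : 𝓓(B, ℝ)), weightedNorm B p (φ i) u ≤ K * eLpNorm (fderiv ℝ u) 2 volume)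
    (hmeas : ∀ i, AEMeasurable (φ i) volume)
    (hnonneg : ∀ i x, 0 ≤ φ i x) (hbdd : ∀ i, ∃ M : ℝ, ∀ x, φ i x ≤ M)
    (hsupp : ∀ i, tsupport (φ i) ⊆ (B : Set (E d))) (hne : ∃ i, ¬ (φ i =ᵐ[volume] 0)) :
    ∃ Λ : NNReal, 0 < Λ ∧
      (∀ u : 𝓓(B, ℝ), constraintFun B p φ u ≤ Λ * eLpNorm (fderiv ℝ u) 2 volume ^ 2) ∧
      ∃ u : ℕ → 𝓓(B, ℝ), (∀ k, eLpNorm (fderiv ℝ (u k)) 2 volume ≤ 1) ∧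
        Tendsto (fun k => constraintFun B p φ (u k)) atTop (𝓝 Λ) := by
  have hQ : ∀ u : 𝓓(B, ℝ), constraintFun B p φ u
      ≤ n * (K * eLpNorm (fderiv ℝ u) 2 volume) ^ 2 := fun u =>
    constraintFun_le_of_forall_weightedNorm_le fun i => hK i u
  set S : Set ℝ≥0∞ := {q | ∃ u : 𝓓(B, ℝ), eLpNorm (fderiv ℝ u) 2 volume ≤ 1 ∧
    q = constraintFun B p φ u} with hS
  have hSK : ∀ q ∈ S, q ≤ n * (K:ℝ≥0∞) ^ 2 := by
    rintro _ ⟨u, hu, rfl⟩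
    refine (hQ u).trans ?_
    gcongr
    exact mul_le_of_le_one_right' hu
  have hsSup : sSup S ≠ ⊤ :=
    ((sSup_le hSK).trans_lt (ENNReal.mul_lt_top (by simp) (by simp))).ne
  have hscale : ∀ (u : 𝓓(B, ℝ)) (c : ℝ), constraintFun B p φ (c • u : 𝓓(B, ℝ))
      = ‖c‖ₑ ^ 2 * constraintFun B p φ u := fun u c => constraintFun_const_mul c u
  have hgscale : ∀ (u : 𝓓(B, ℝ)) (c : ℝ), gradLp (c • u) = c • gradLp u := fun u c => by
    have := gradLp_linearComb u u c 0
    rwa [zero_smul, zero_smul, add_zero, add_zero] at this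
  have hne0 : S.Nonempty := by
    refine ⟨_, (0:ℝ) • 0, ?_, rfl⟩
    rw [eLpNorm_fderiv_eq, hgscale, zero_smul, norm_zero]
    simp
  -- scale `u` to the unit sphere; if `‖∇u‖₂ = 0` the functional vanishes by `hK`
  have hle : ∀ u : 𝓓(B, ℝ), constraintFun B p φ u
      ≤ sSup S * eLpNorm (fderiv ℝ u) 2 volume ^ 2 := by
    intro u
    rcases (norm_nonneg (gradLp u)).eq_or_lt with h0 | hpos
    · have h1 : eLpNorm (fderiv ℝ u) 2 volume = 0 := by rw [eLpNorm_fderiv_eq, ← h0]; simp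
      have := hQ u
      rw [h1] at this ⊢
      simpa using this
    · set c := ‖gradLp u‖ with hc
      have hmem : constraintFun B p φ (c⁻¹ • u : 𝓓(B, ℝ)) ∈ S := by
        refine ⟨_, ?_, rfl⟩
        rw [eLpNorm_fderiv_eq, hgscale, norm_smul, Real.norm_of_nonneg (inv_nonneg.2 hpos.le),
          ← hc, inv_mul_cancel₀ hpos.ne']
        simp
      have hu : u = c • (c⁻¹ • u) := by rw [smul_smul, mul_inv_cancel₀ hpos.ne', one_smul]
      have h2 : constraintFun B p φ u
          = ‖c‖ₑ ^ 2 * constraintFun B p φ (c⁻¹ • u : 𝓓(B, ℝ)) := by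
        rw [← hscale, ← hu]
      rw [h2, eLpNorm_fderiv_eq, ← hc, Real.enorm_of_nonneg hpos.le, mul_comm]
      gcongr
      exact le_sSup hmem
  have hpos : 0 < sSup S := by
    rw [pos_iff_ne_zero]
    intro h0
    obtain ⟨i, hi⟩ := hne
    refine hi (ae_eq_zero_of_constraintFun_eq_zero hp hmeas hnonneg hbdd hsupp (fun u => ?_) i)
    have := hle u
    rwa [h0, zero_mul, nonpos_iff_eq_zero] at this
  obtain ⟨q, -, hq, hqS⟩ := exists_seq_tendsto_sSup hne0 (OrderTop.bddAbove S)
  choose u hu hqu using hqS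
  refine ⟨(sSup S).toNNReal, ENNReal.toNNReal_pos hpos.ne' hsSup, fun u => ?_, u, hu, ?_⟩
  · rw [ENNReal.coe_toNNReal hsSup]
    exact hle u
  · rw [ENNReal.coe_toNNReal hsSup]
    exact hq.congr hqu

/-- Along a maximising sequence that is Cauchy for the weighted norms, the parallelogram law forces
the gradients to be Cauchy in `L²`: the sum of two late members is again nearly optimal. -/
lemma cauchySeq_gradLp (hp : 1 ≤ p) {K Λ : NNReal} (hΛ : 0 < Λ)
    (hK : ∀ i (u : 𝓓(B, ℝ)), weightedNorm B p (φ i) u ≤ K * eLpNorm (fderiv ℝ u) 2 volume)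
    (hmeas : ∀ i, AEMeasurable (φ i) volume)
    (hle : ∀ u : 𝓓(B, ℝ), constraintFun B p φ u ≤ Λ * eLpNorm (fderiv ℝ u) 2 volume ^ 2)
    {u : ℕ → 𝓓(B, ℝ)} (hu : ∀ k, eLpNorm (fderiv ℝ (u k)) 2 volume ≤ 1)
    (hlim : Tendsto (fun k => constraintFun B p φ (u k)) atTop (𝓝 Λ))
    (hcau : ∀ δ : ℝ≥0∞, 0 < δ → ∃ N, ∀ k ≥ N, ∀ l ≥ N, ∀ i,
      weightedNorm B p (φ i) (fun x => u k x - u l x) ≤ δ) :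
    CauchySeq fun k => gradLp (u k) := by
  have hG : ∀ k, ‖gradLp (u k)‖ ≤ 1 := fun k => by
    rw [norm_gradLp]
    exact ENNReal.toReal_le_of_le_ofReal zero_le_one (by simpa using hu k)
  have hw1 : ∀ i k, weightedNorm B p (φ i) (u k) ≤ K := fun i k =>
    (hK i (u k)).trans (mul_le_of_le_one_right' (hu k))
  -- the sum of two members nearly attains the best constant
  have hsum : ∀ ε : NNReal, 0 < ε → ∃ N, ∀ k ≥ N, ∀ l ≥ N,
      4 * (Λ:ℝ) - ε ≤ Λ * ‖gradLp (u k) + gradLp (u l)‖ ^ 2 := by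
    intro ε hε
    have hlim0 : Tendsto (fun δ : ℝ≥0∞ => (n:ℝ≥0∞) * ((4 * K + δ) * δ)) (𝓝 0) (𝓝 0) := by
      have h1 : Tendsto (fun δ : ℝ≥0∞ => 4 * (K:ℝ≥0∞) + δ) (𝓝 0) (𝓝 (4 * K + 0)) :=
        tendsto_id.const_add (4 * (K:ℝ≥0∞))
      have h2 := ENNReal.Tendsto.const_mul (a := (n:ℝ≥0∞)) (ENNReal.Tendsto.mul h1
        (Or.inr (by simp)) tendsto_id (Or.inr (by simp [ENNReal.mul_eq_top]))) (Or.inr (by simp))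
      simpa using h2
    have hε2 : (0:ℝ≥0∞) < (ε / 2 : NNReal) := by exact_mod_cast half_pos hε
    obtain ⟨δ, hδ, hδ0⟩ : ∃ δ : ℝ≥0∞, (n:ℝ≥0∞) * ((4 * K + δ) * δ) ≤ (ε / 2 : NNReal) ∧ 0 < δ :=
      (((hlim0.mono_left nhdsWithin_le_nhds).eventually (ge_mem_nhds hε2)).and
        (self_mem_nhdsWithin (s := Set.Ioi (0:ℝ≥0∞)))).exists
    obtain ⟨N₁, hN₁⟩ := hcau δ hδ0
    have hev : ∀ᶠ k in atTop, (Λ:ℝ≥0∞) ≤ constraintFun B p φ (u k) + (ε / 8 : NNReal) := by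
      have h8 : (0:ℝ≥0∞) < (ε / 8 : NNReal) := by
        exact_mod_cast div_pos hε (by norm_num : (0:NNReal) < 8)
      have := hlim.add_const ((ε / 8 : NNReal) : ℝ≥0∞)
      exact this.eventually (le_mem_nhds (ENNReal.lt_add_right (by simp) h8.ne'))
    obtain ⟨N₂, hN₂⟩ := hev.exists_forall_of_atTop
    refine ⟨max N₁ N₂, fun k hk l hl => ?_⟩
    have hk1 := le_of_max_le_left hk; have hk2 := le_of_max_le_right hk
    have hl1 := le_of_max_le_left hl
    set v : 𝓓(B, ℝ) := (1:ℝ) • u k + (1:ℝ) • u l with hv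
    have hvx : ∀ x, v x = u k x + u l x := fun x => by
      rw [hv, TestFunction.linearComb_apply]; ring
    have hm : ∀ w : 𝓓(B, ℝ), AEStronglyMeasurable (w : E d → ℝ) (leb B) := fun w =>
      w.continuous.aestronglyMeasurable
    have hi : ∀ i, 4 * weightedNorm B p (φ i) (u k) ^ 2
        ≤ weightedNorm B p (φ i) v ^ 2 + (4 * K + δ) * δ := by
      intro i
      set s := weightedNorm B p (φ i) v with hs
      have h1 : 2 * weightedNorm B p (φ i) (u k) ≤ s + δ := by
        have e1 : weightedNorm B p (φ i) (fun x => 2 * u k x)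
            = 2 * weightedNorm B p (φ i) (u k) := by
          rw [weightedNorm_const_mul, Real.enorm_of_nonneg zero_le_two]; simp
        have e2 : (fun x => 2 * u k x) = fun x => v x + (u k x - u l x) := by
          funext x; rw [hvx]; ring
        rw [← e1, e2]
        exact (weightedNorm_add_le hp (hmeas i) (hm v) ((hm _).sub (hm _))).trans
          (add_le_add le_rfl (hN₁ k hk1 l hl1 i))
      have h2 : s ≤ 2 * K := by
        have e2 : (v : E d → ℝ) = fun x => u k x + u l x := funext hvx
        rw [hs, e2, two_mul]
        exact (weightedNorm_add_le hp (hmeas i) (hm _) (hm _)).trans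
          (add_le_add (hw1 i k) (hw1 i l))
      calc 4 * weightedNorm B p (φ i) (u k) ^ 2 = (2 * weightedNorm B p (φ i) (u k)) ^ 2 := by ring
        _ ≤ (s + δ) ^ 2 := by gcongr
        _ = s ^ 2 + (2 * s + δ) * δ := by ring
        _ ≤ s ^ 2 + (2 * (2 * K) + δ) * δ := by gcongr
        _ = _ := by ring
    have h4 : 4 * constraintFun B p φ (u k)
        ≤ ENNReal.ofReal (Λ * ‖gradLp (u k) + gradLp (u l)‖ ^ 2) + (ε / 2 : NNReal) := by
      calc 4 * constraintFun B p φ (u k) = ∑ i, 4 * weightedNorm B p (φ i) (u k) ^ 2 := by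
            rw [constraintFun, Finset.mul_sum]
        _ ≤ ∑ i, (weightedNorm B p (φ i) v ^ 2 + (4 * K + δ) * δ) :=
            Finset.sum_le_sum fun i _ => hi i
        _ = constraintFun B p φ v + n * ((4 * K + δ) * δ) := by
            rw [Finset.sum_add_distrib, constraintFun]; simp
        _ ≤ Λ * eLpNorm (fderiv ℝ v) 2 volume ^ 2 + (ε / 2 : NNReal) := add_le_add (hle v) hδ
        _ = _ := by
            rw [eLpNorm_fderiv_eq, hv, gradLp_linearComb, one_smul, one_smul,
              ENNReal.ofReal_mul Λ.coe_nonneg, ENNReal.ofReal_pow (norm_nonneg _),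
              ENNReal.ofReal_coe_nnreal]
    have h5 : (4:ℝ≥0∞) * Λ ≤ ENNReal.ofReal (Λ * ‖gradLp (u k) + gradLp (u l)‖ ^ 2 + ε) := by
      calc (4:ℝ≥0∞) * Λ ≤ 4 * (constraintFun B p φ (u k) + (ε / 8 : NNReal)) := by
            gcongr; exact hN₂ k hk2
        _ = 4 * constraintFun B p φ (u k) + ((4 * (ε / 8) : NNReal) : ℝ≥0∞) := by
            rw [mul_add]; push_cast; rfl
        _ ≤ (ENNReal.ofReal (Λ * ‖gradLp (u k) + gradLp (u l)‖ ^ 2) + (ε / 2 : NNReal))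
            + ((4 * (ε / 8) : NNReal) : ℝ≥0∞) := by gcongr
        _ = ENNReal.ofReal (Λ * ‖gradLp (u k) + gradLp (u l)‖ ^ 2) + (ε : ℝ≥0∞) := by
            rw [add_assoc, ← ENNReal.coe_add]
            congr 2
            rw [← NNReal.coe_inj]; push_cast; ring
        _ = _ := by
            rw [ENNReal.ofReal_add (by positivity) ε.coe_nonneg, ENNReal.ofReal_coe_nnreal]
    have h6 := ENNReal.toReal_le_of_le_ofReal (by positivity) h5
    simp only [ENNReal.toReal_mul, ENNReal.toReal_ofNat, ENNReal.coe_toReal] at h6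
    linarith
  rw [Metric.cauchySeq_iff]
  intro e he
  have hΛ' : (0:ℝ) < Λ := by exact_mod_cast hΛ
  set ε : NNReal := Λ * e.toNNReal ^ 2 / 2 with hε
  have hεpos : 0 < ε := by
    have : 0 < e.toNNReal := Real.toNNReal_pos.2 he
    positivity
  have hεr : (ε:ℝ) = Λ * e ^ 2 / 2 := by
    rw [hε]; push_cast; rw [Real.coe_toNNReal _ he.le]
  obtain ⟨N, hN⟩ := hsum ε hεpos
  refine ⟨N, fun k hk l hl => ?_⟩
  rw [dist_eq_norm]
  have hpar := parallelogram_law_with_norm ℝ (gradLp (u k)) (gradLp (u l))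
  have h1 := hN k hk l hl
  have h2 : ‖gradLp (u k)‖ ^ 2 ≤ 1 := pow_le_one₀ (norm_nonneg _) (hG k)
  have h3 : ‖gradLp (u l)‖ ^ 2 ≤ 1 := pow_le_one₀ (norm_nonneg _) (hG l)
  have h4 : (Λ:ℝ) * ‖gradLp (u k) - gradLp (u l)‖ ^ 2 ≤ Λ * (e ^ 2 / 2) := by
    have : ‖gradLp (u k) - gradLp (u l)‖ ^ 2 ≤ 4 - ‖gradLp (u k) + gradLp (u l)‖ ^ 2 := by
      linarith
    nlinarith
  have h5 := le_of_mul_le_mul_left h4 hΛ'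
  refine lt_of_pow_lt_pow_left₀ 2 he.le ?_
  nlinarith [sq_pos_of_pos he]

/-- The best constant is attained by an element of `𝒟(B)`. -/
lemma exists_maximiser (hd : 1 ≤ d) (hp : 1 ≤ p) (hpd : (p : ℤ) * ((d : ℤ) - 2) < (d : ℤ))
    (hB : Bornology.IsBounded (B : Set (E d)) ∨ (B = ⊤ ∧ 3 ≤ d))
    (hmeas : ∀ i, AEMeasurable (φ i) volume) (hnonneg : ∀ i x, 0 ≤ φ i x)
    (hbdd : ∀ i, ∃ M : ℝ, ∀ x, φ i x ≤ M) (hcomp : ∀ i, HasCompactSupport (φ i))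
    (hsupp : ∀ i, tsupport (φ i) ⊆ (B : Set (E d))) (hne : ∃ i, ¬ (φ i =ᵐ[volume] 0)) :
    ∃ Λ : NNReal, 0 < Λ ∧
      (∀ u : 𝓓(B, ℝ), constraintFun B p φ u ≤ Λ * eLpNorm (fderiv ℝ u) 2 volume ^ 2) ∧
      ∃ (ψ : E d → ℝ) (g : E d → E d), HasDGradient B ψ g ∧ Λ ≤ constraintFun B p φ ψ ∧
        eLpNorm g 2 (leb B) ≤ 1 := by
  have hp' : (1:ℝ) ≤ p := by exact_mod_cast hp
  obtain ⟨r, hr, C, hS⟩ := exists_sobolev hd hp hpd hB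
  obtain ⟨K, hK⟩ := exists_weightedNorm_le_eLpNorm (B := B) hp hr hnonneg hbdd hcomp
  have hKC : ∀ i (u : 𝓓(B, ℝ)), weightedNorm B p (φ i) u
      ≤ (K * C : NNReal) * eLpNorm (fderiv ℝ u) 2 volume := fun i u => by
    rw [ENNReal.coe_mul, mul_assoc]
    exact (hK i u u.continuous.aestronglyMeasurable).trans (mul_le_mul_right (hS u) _)
  obtain ⟨Λ, hΛ, hle, u₀, hu₀, hlim₀⟩ := exists_best_constant hp hKC hmeas hnonneg hbdd hsupp hne
  refine ⟨Λ, hΛ, hle, ?_⟩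
  obtain ⟨σ, hσ, hcau⟩ := exists_subseq_weightedNorm_cauchy hp hr hS hnonneg hbdd hcomp u₀ hu₀
  set u : ℕ → 𝓓(B, ℝ) := fun k => u₀ (σ k) with hudef
  have hlim : Tendsto (fun k => constraintFun B p φ (u k)) atTop (𝓝 Λ) :=
    hlim₀.comp hσ.tendsto_atTop
  have hG := cauchySeq_gradLp hp hΛ hKC hmeas hle (u := u) (fun k => hu₀ _) hlim hcau
  have hr2 : (2 : NNReal) ≤ r := by rw [← NNReal.coe_le_coe]; push_cast; linarith
  have : Fact (1 ≤ (r : ℝ≥0∞)) := ⟨by exact_mod_cast le_trans (by norm_num) hr2⟩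
  have hU : CauchySeq fun k => (TestFunction.memLp (u k) r).toLp := by
    rw [Metric.cauchySeq_iff] at hG ⊢
    intro e he
    obtain ⟨N, hN⟩ := hG (e / (C + 1)) (by positivity)
    refine ⟨N, fun k hk l hl => ?_⟩
    have h1 := hN k hk l hl
    rw [dist_eq_norm, lt_div_iff₀ (by positivity)] at h1
    rw [dist_eq_norm, ← MemLp.toLp_sub, Lp.norm_toLp]
    set v : 𝓓(B, ℝ) := (1:ℝ) • u k + (-1:ℝ) • u l with hv
    have e1 : (u k : E d → ℝ) - u l = v := by
      funext x; rw [hv, TestFunction.linearComb_apply, Pi.sub_apply]; ring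
    have e2 : gradLp v = gradLp (u k) - gradLp (u l) := by
      rw [hv, gradLp_linearComb, one_smul, neg_one_smul, sub_eq_add_neg]
    have h2 := ENNReal.toReal_mono (by rw [eLpNorm_fderiv_eq]; finiteness) (hS v)
    rw [ENNReal.toReal_mul, ← norm_gradLp, e2, ENNReal.coe_toReal] at h2
    rw [e1]
    refine h2.trans_lt ?_
    nlinarith [norm_nonneg (gradLp (u k) - gradLp (u l))]
  obtain ⟨g, hg⟩ := cauchySeq_tendsto_of_complete hG
  obtain ⟨ψ, hψ⟩ := cauchySeq_tendsto_of_complete hU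
  have hlimg : Tendsto (fun k => eLpNorm (fun x => gradient (u k) x - g x) 2 volume) atTop (𝓝 0) :=
    (Lp.tendsto_Lp_iff_tendsto_eLpNorm'' (fun k => gradient (u k))
      (fun k => TestFunction.memLp_gradient (u k) 2) g (Lp.memLp g)).1
      (by rw [Lp.toLp_coeFn]; exact hg)
  have hlimψ : Tendsto (fun k => eLpNorm (fun x => u k x - ψ x) r volume) atTop (𝓝 0) :=
    (Lp.tendsto_Lp_iff_tendsto_eLpNorm'' (fun k => (u k : E d → ℝ))
      (fun k => TestFunction.memLp (u k) r) ψ (Lp.memLp ψ)).1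
      (by rw [Lp.toLp_coeFn]; exact hψ)
  refine ⟨ψ, g, hasDGradient_of_tendsto (hB.imp_right And.left) hr2 (Lp.memLp ψ) (Lp.memLp g)
    hlimψ hlimg, ?_, ?_⟩
  · -- the constraint functional is continuous along the sequence
    have hψm : AEStronglyMeasurable ψ volume := Lp.aestronglyMeasurable ψ
    have hum : ∀ k, AEStronglyMeasurable (u k : E d → ℝ) volume := fun k =>
      (u k).continuous.aestronglyMeasurable
    have hw : ∀ k i, weightedNorm B p (φ i) (u k) ≤ weightedNorm B p (φ i) ψ
        + K * eLpNorm (fun x => u k x - ψ x) r volume := fun k i => by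
      have e : (u k : E d → ℝ) = fun x => ψ x + (u k x - ψ x) := by funext x; ring
      have := weightedNorm_add_le (B := B) hp (hmeas i) hψm.restrict ((hum k).sub hψm).restrict
      calc weightedNorm B p (φ i) (u k)
          = weightedNorm B p (φ i) (fun x => ψ x + (u k x - ψ x)) := by rw [← e]
        _ ≤ _ := this.trans (add_le_add le_rfl (hK i _ ((hum k).sub hψm)))
    have hlimK : Tendsto (fun k => K * eLpNorm (fun x => u k x - ψ x) r volume) atTop (𝓝 0) := by
      simpa using ENNReal.Tendsto.const_mul (a := (K:ℝ≥0∞)) hlimψ (Or.inr (by simp))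
    have hlims : Tendsto (fun k => ∑ i, (weightedNorm B p (φ i) ψ
        + K * eLpNorm (fun x => u k x - ψ x) r volume) ^ 2) atTop
        (𝓝 (∑ i, weightedNorm B p (φ i) ψ ^ 2)) := by
      refine tendsto_finsetSum _ fun i _ => ?_
      have h1 := hlimK.const_add (weightedNorm B p (φ i) ψ)
      rw [add_zero] at h1
      exact (ENNReal.continuous_pow 2).continuousAt.tendsto.comp h1
    exact le_of_tendsto_of_tendsto' hlim hlims fun k =>
      Finset.sum_le_sum fun i _ => pow_le_pow_left' (hw k i) 2
  · have h1 : ‖g‖ ≤ 1 := le_of_tendsto' hg.norm fun k => by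
      rw [norm_gradLp]
      exact ENNReal.toReal_le_of_le_ofReal zero_le_one (by simpa using hu₀ (σ k))
    refine (eLpNorm_mono_measure _ Measure.restrict_le_self).trans ?_
    rw [Lp.norm_def] at h1
    rw [← ENNReal.ofReal_toReal (Lp.eLpNorm_ne_top g)]
    exact ENNReal.ofReal_le_one.2 h1

end

section

variable {d n p : ℕ} {B : TopologicalSpace.Opens (E d)} {φ : Fin n → E d → ℝ}

/-! ### The variational problem in terms of the best constant -/

lemma Theta_le_energy {ψ : E d → ℝ} {g : E d → E d} (h : HasDGradient B ψ g)
    (hψ : Constraint B p φ ψ) : Theta B p φ ≤ energy B p g :=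
  csInf_le ⟨0, by
    rintro _ ⟨_, _, -, -, rfl⟩
    unfold energy
    positivity⟩ ⟨ψ, g, h, hψ, rfl⟩

lemma HasDGradient.const_mul {ψ : E d → ℝ} {g : E d → E d} (h : HasDGradient B ψ g) (c : ℝ) :
    HasDGradient B (fun x => c * ψ x) (fun x => c • g x) := by
  have := h.linearComb 0 c 0
  simpa using this

lemma energy_const_smul (g : E d → E d) (c : ℝ) :
    energy B p (fun x => c • g x) = c ^ 2 * energy B p g := by
  have : eLpNorm (fun x => c • g x) 2 (leb B) = ‖c‖ₑ * eLpNorm g 2 (leb B) :=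
    eLpNorm_const_smul c g 2 (leb B)
  rw [energy, this, ENNReal.toReal_mul, energy, toReal_enorm, Real.norm_eq_abs, mul_pow, sq_abs]
  ring

/-- The homogeneous form of the definition of `Θ`. -/
lemma Theta_mul_le_energy {ψ : E d → ℝ} {g : E d → E d} (h : HasDGradient B ψ g)
    (hψ : constraintFun B p φ ψ ≠ ⊤) :
    Theta B p φ * (constraintFun B p φ ψ).toReal ≤ energy B p g := by
  rcases eq_or_ne (constraintFun B p φ ψ) 0 with h0 | h0
  · rw [h0, ENNReal.toReal_zero, mul_zero]
    unfold energy
    positivity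
  · have hq : 0 < (constraintFun B p φ ψ).toReal := ENNReal.toReal_pos h0 hψ
    set q := (constraintFun B p φ ψ).toReal with hqdef
    set c := (Real.sqrt q)⁻¹ with hc
    have hc2 : c ^ 2 = q⁻¹ := by rw [hc, inv_pow, Real.sq_sqrt hq.le]
    have hcon : Constraint B p φ (fun x => c * ψ x) := by
      change constraintFun B p φ (fun x => c * ψ x) = 1
      rw [constraintFun_const_mul, ← ENNReal.ofReal_toReal hψ, ← hqdef,
        Real.enorm_of_nonneg (by positivity), ← ENNReal.ofReal_pow (by positivity), hc2,
        ← ENNReal.ofReal_mul (by positivity), inv_mul_cancel₀ hq.ne', ENNReal.ofReal_one]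
    have := Theta_le_energy (h.const_mul c) hcon
    rw [energy_const_smul, hc2, inv_mul_eq_div, le_div_iff₀ hq] at this
    exact this

/-- A function that attains the best constant in `∑ᵢ ‖φᵢ ψ‖²_{2p} ≤ Λ ‖∇ψ‖₂²` is, after
normalisation, a minimiser. -/
lemma isMinimiser_of_maximiser {Λ : NNReal} (hΛ : 0 < Λ)
    (hle : ∀ (ψ : E d → ℝ) (g : E d → E d), HasDGradient B ψ g →
      constraintFun B p φ ψ ≤ Λ * eLpNorm g 2 (leb B) ^ 2)
    (hgr : ∀ (ψ : E d → ℝ) (g : E d → E d), HasDGradient B ψ g → eLpNorm g 2 (leb B) ≠ ⊤)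
    {ψ : E d → ℝ} {g : E d → E d} (h : HasDGradient B ψ g) (hψ : Λ ≤ constraintFun B p φ ψ)
    (hg : eLpNorm g 2 (leb B) ≤ 1) : ∃ ψ : E d → ℝ, IsMinimiser B p φ ψ := by
  have hΛ' : (0:ℝ) < Λ := by exact_mod_cast hΛ
  have hQ : constraintFun B p φ ψ = Λ := by
    refine le_antisymm ((hle ψ g h).trans ?_) hψ
    refine mul_le_of_le_one_right' ?_
    simpa using pow_le_pow_left' hg 2
  -- every competitor has energy at least `p / (2 Λ)`
  have hlow : ∀ (f : E d → ℝ) (k : E d → E d), HasDGradient B f k → Constraint B p φ f →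
      (p : ℝ) / 2 * (Λ:ℝ)⁻¹ ≤ energy B p k := by
    intro f k hk hf
    have h1 : (1:ℝ≥0∞) ≤ Λ * eLpNorm k 2 (leb B) ^ 2 := by
      have h2 : constraintFun B p φ f = 1 := hf
      rw [← h2]
      exact hle f k hk
    have h2 := ENNReal.toReal_mono (by have := hgr f k hk; finiteness) h1
    rw [ENNReal.toReal_one, ENNReal.toReal_mul, ENNReal.coe_toReal, ENNReal.toReal_pow] at h2
    rw [energy]
    refine mul_le_mul_of_nonneg_left ?_ (by positivity)
    rwa [inv_le_iff_one_le_mul₀' hΛ']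
  set c := (Real.sqrt Λ)⁻¹ with hc
  have hc2 : c ^ 2 = (Λ:ℝ)⁻¹ := by rw [hc, inv_pow, Real.sq_sqrt hΛ'.le]
  have hcon : Constraint B p φ (fun x => c * ψ x) := by
    change constraintFun B p φ (fun x => c * ψ x) = 1
    rw [constraintFun_const_mul, hQ, Real.enorm_of_nonneg (by positivity),
      ← ENNReal.ofReal_pow (by positivity), hc2, ← ENNReal.ofReal_coe_nnreal,
      ← ENNReal.ofReal_mul (by positivity), inv_mul_cancel₀ hΛ'.ne', ENNReal.ofReal_one]
  refine ⟨_, _, h.const_mul c, hcon, le_antisymm ?_ (Theta_le_energy (h.const_mul c) hcon)⟩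
  refine le_csInf ⟨_, _, _, h.const_mul c, hcon, rfl⟩ ?_
  rintro _ ⟨f, k, hk, hf, rfl⟩
  refine le_trans ?_ (hlow f k hk hf)
  rw [energy_const_smul, hc2, energy]
  have h1 : (eLpNorm g 2 (leb B)).toReal ≤ 1 := ENNReal.toReal_le_of_le_ofReal zero_le_one
    (by simpa using hg)
  have h2 : (eLpNorm g 2 (leb B)).toReal ^ 2 ≤ 1 := pow_le_one₀ ENNReal.toReal_nonneg h1
  calc (Λ:ℝ)⁻¹ * ((p:ℝ) / 2 * (eLpNorm g 2 (leb B)).toReal ^ 2)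
      = (p:ℝ) / 2 * (Λ:ℝ)⁻¹ * (eLpNorm g 2 (leb B)).toReal ^ 2 := by ring
    _ ≤ _ := mul_le_of_le_one_right (by positivity) h2

lemma HasDGradient.memLp_grad {ψ : E d → ℝ} {g : E d → E d} (h : HasDGradient B ψ g) :
    MemLp g 2 (leb B) := by
  rcases h with ⟨-, h⟩ | ⟨rfl, h⟩
  · exact h.memLp_grad
  · exact h.memLp_grad.restrict _

lemma HasDGradient.weakGradient {ψ : E d → ℝ} {g : E d → E d} (h : HasDGradient B ψ g) :
    HasWeakGradient B ψ g := by
  rcases h with ⟨-, h⟩ | ⟨rfl, h⟩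
  · exact h.weakGradient
  · exact h.weakGradient

/-! ### First variation -/

/-- Differentiation under the integral sign for `t ↦ ∫ (a + t b) ^ m`. -/
lemma hasDerivAt_integral_add_mul_pow {α : Type*} [MeasurableSpace α] {μ : Measure α}
    {a b : α → ℝ} {m : ℕ} (hm : 1 ≤ m) (ha : MemLp a m μ) (hb : MemLp b m μ) :
    Integrable (fun x => a x ^ (m - 1) * b x) μ ∧
      HasDerivAt (fun t : ℝ => ∫ x, (a x + t * b x) ^ m ∂μ)
        (m * ∫ x, a x ^ (m - 1) * b x ∂μ) 0 := by
  have hm0 : m ≠ 0 := by omega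
  have hmR : (0:ℝ) < m := by exact_mod_cast hm
  have hS : MemLp (fun x => |a x| + |b x|) m μ := ha.abs.add hb.abs
  have hSint : Integrable (fun x => (|a x| + |b x|) ^ m) μ := by
    refine (hS.integrable_norm_pow hm0).congr (Eventually.of_forall fun x => ?_)
    simp only [Real.norm_eq_abs]
    rw [abs_of_nonneg (by positivity)]
  have haint : Integrable (fun x => a x ^ m) μ :=
    (ha.integrable_norm_pow hm0).mono' (ha.1.pow m) (Eventually.of_forall fun x => by simp)
  have key := hasDerivAt_integral_of_dominated_loc_of_deriv_le (μ := μ) (𝕜 := ℝ)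
    (F := fun (t : ℝ) x => (a x + t * b x) ^ m)
    (F' := fun (t : ℝ) x => m * (a x + t * b x) ^ (m - 1) * b x) (x₀ := 0)
    (bound := fun x => m * (|a x| + |b x|) ^ m) (s := Metric.ball 0 1)
    (Metric.ball_mem_nhds 0 one_pos)
    (Eventually.of_forall fun t => ((ha.1.add (hb.1.const_mul t)).pow m))
    (by simpa using haint)
    ((((ha.1.add (hb.1.const_mul 0)).pow (m - 1)).const_mul (m:ℝ)).mul hb.1)
    (Eventually.of_forall fun x t ht => by
      have ht1 : |t| ≤ 1 := (by simpa using ht : |t| < 1).le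
      rw [norm_mul, norm_mul, norm_pow, Real.norm_of_nonneg hmR.le, mul_assoc]
      refine mul_le_mul_of_nonneg_left ?_ hmR.le
      simp only [Real.norm_eq_abs]
      have h1 : |a x + t * b x| ≤ |a x| + |b x| := by
        refine (abs_add_le _ _).trans ?_
        rw [abs_mul]
        have := mul_le_of_le_one_left (abs_nonneg (b x)) ht1
        linarith
      calc |a x + t * b x| ^ (m - 1) * |b x|
          ≤ (|a x| + |b x|) ^ (m - 1) * (|a x| + |b x|) := by
            gcongr
            exact le_add_of_nonneg_left (abs_nonneg _)
        _ = (|a x| + |b x|) ^ m := by rw [← pow_succ]; congr 1; omega)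
    (hSint.const_mul _)
    (Eventually.of_forall fun x t _ => by
      have h1 : HasDerivAt (fun t : ℝ => a x + t * b x) (b x) t := by
        simpa using ((hasDerivAt_id t).mul_const (b x)).const_add (a x)
      exact h1.pow m)
  simp only [zero_mul, add_zero] at key
  refine ⟨?_, ?_⟩
  · have := key.1.const_mul (m:ℝ)⁻¹
    refine this.congr (Eventually.of_forall fun x => ?_)
    simp only
    field_simp
  · have e : (m:ℝ) * ∫ x, a x ^ (m - 1) * b x ∂μ = ∫ x, m * a x ^ (m - 1) * b x ∂μ := by
      rw [← integral_const_mul]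
      congr 1
      funext x
      ring
    rw [e]
    exact key.2

lemma toReal_eLpNorm_pow {α : Type*} [MeasurableSpace α] {μ : Measure α} {f : α → ℝ} {p : ℕ}
    (hp : 1 ≤ p) (hf : MemLp f ((2 * p : ℕ) : ℝ≥0∞) μ) :
    (eLpNorm f ((2 * p : ℕ) : ℝ≥0∞) μ).toReal ^ (2 * p) = ∫ x, f x ^ (2 * p) ∂μ := by
  have h0 : 2 * p ≠ 0 := by omega
  rw [hf.eLpNorm_eq_integral_rpow_norm (by exact_mod_cast h0) (ENNReal.natCast_ne_top _),
    ENNReal.toReal_ofReal (by positivity), ENNReal.toReal_natCast, ← Real.rpow_natCast,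
    ← Real.rpow_mul (by positivity), inv_mul_cancel₀ (by exact_mod_cast h0), Real.rpow_one]
  congr 1
  funext x
  rw [Real.rpow_natCast, Real.norm_eq_abs, pow_mul, sq_abs, ← pow_mul]

/-- The first variation of `t ↦ ‖a + t b‖²_{2p}` at `t = 0`. If `a = 0` almost everywhere, both
sides vanish. -/
lemma hasDerivAt_toReal_eLpNorm_sq {α : Type*} [MeasurableSpace α] {μ : Measure α} {a b : α → ℝ}
    {p : ℕ} (hp : 1 ≤ p) (ha : MemLp a ((2 * p : ℕ) : ℝ≥0∞) μ)
    (hb : MemLp b ((2 * p : ℕ) : ℝ≥0∞) μ) :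
    HasDerivAt (fun t : ℝ =>
        (eLpNorm (fun x => a x + t * b x) ((2 * p : ℕ) : ℝ≥0∞) μ).toReal ^ 2)
      (2 * ((eLpNorm a ((2 * p : ℕ) : ℝ≥0∞) μ).toReal ^ (2 - 2 * (p : ℤ)) *
        ∫ x, a x ^ (2 * p - 1) * b x ∂μ)) 0 := by
  have hp0 : (p:ℝ) ≠ 0 := by positivity
  have h2p : 2 * p ≠ 0 := by omega
  have hmem : ∀ t : ℝ, MemLp (fun x => a x + t * b x) ((2 * p : ℕ) : ℝ≥0∞) μ := fun t =>
    ha.add (hb.const_mul t)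
  rcases (ENNReal.toReal_nonneg (a := eLpNorm a ((2 * p : ℕ) : ℝ≥0∞) μ)).eq_or_lt with h0 | hpos
  · have hae : a =ᵐ[μ] 0 := by
      refine (eLpNorm_eq_zero_iff ha.1 (Nat.cast_ne_zero.2 h2p)).1 ?_
      exact ((ENNReal.toReal_eq_zero_iff _).1 h0.symm).resolve_right ha.2.ne
    have hJ : ∫ x, a x ^ (2 * p - 1) * b x ∂μ = 0 := by
      refine integral_eq_zero_of_ae (hae.mono fun x hx => ?_)
      have h1 : 2 * p - 1 ≠ 0 := by omega
      simp [hx, zero_pow h1]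
    have hsq : (fun t : ℝ => (eLpNorm (fun x => a x + t * b x) ((2 * p : ℕ) : ℝ≥0∞) μ).toReal ^ 2)
        = fun t => t ^ 2 * (eLpNorm b ((2 * p : ℕ) : ℝ≥0∞) μ).toReal ^ 2 := by
      funext t
      have h1 : eLpNorm (fun x => a x + t * b x) ((2 * p : ℕ) : ℝ≥0∞) μ
          = eLpNorm (t • b) ((2 * p : ℕ) : ℝ≥0∞) μ :=
        eLpNorm_congr_ae (hae.mono fun x hx => by simp [hx])
      rw [h1, eLpNorm_const_smul, ENNReal.toReal_mul, mul_pow, toReal_enorm, Real.norm_eq_abs,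
        sq_abs]
    rw [hJ, mul_zero, mul_zero, hsq]
    simpa using (hasDerivAt_pow 2 (0:ℝ)).mul_const ((eLpNorm b ((2 * p : ℕ) : ℝ≥0∞) μ).toReal ^ 2)
  · set N := (eLpNorm a ((2 * p : ℕ) : ℝ≥0∞) μ).toReal with hN
    have hI := (hasDerivAt_integral_add_mul_pow (m := 2 * p) (by omega) ha hb).2
    have hI0 : ∫ x, (a x + 0 * b x) ^ (2 * p) ∂μ = N ^ (2 * p) := by
      rw [hN, toReal_eLpNorm_pow hp ha]
      simp
    have hpow := hI.rpow_const (p := (p:ℝ)⁻¹) (Or.inl (by rw [hI0]; positivity))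
    have hfun : (fun t : ℝ =>
        (eLpNorm (fun x => a x + t * b x) ((2 * p : ℕ) : ℝ≥0∞) μ).toReal ^ 2)
        = fun t => (∫ x, (a x + t * b x) ^ (2 * p) ∂μ) ^ (p:ℝ)⁻¹ := by
      funext t
      rw [← toReal_eLpNorm_pow hp (hmem t), pow_mul, ← Real.rpow_natCast _ p,
        ← Real.rpow_mul (by positivity), mul_inv_cancel₀ hp0, Real.rpow_one]
    rw [hfun]
    convert hpow using 1
    have hexp : (N ^ (2 * p)) ^ ((p:ℝ)⁻¹ - 1) = N ^ (2 - 2 * (p:ℤ)) := by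
      rw [← Real.rpow_natCast, ← Real.rpow_mul hpos.le, ← Real.rpow_intCast]
      congr 1
      push_cast
      field_simp
    rw [hI0, hexp]
    push_cast
    field_simp

/-! ### The Euler–Lagrange equation -/

/-- Integration by parts: `∫ ψ Δη = -∫ ∇ψ · ∇η` for a weakly differentiable `ψ`. -/
lemma HasWeakGradient.integral_mul_laplacian {ψ : E d → ℝ} {g : E d → E d}
    (h : HasWeakGradient B ψ g) (η : 𝓓(B, ℝ)) :
    ∫ x in (B : Set (E d)), ψ x * Δ (η : E d → ℝ) x
      = -∫ x in (B : Set (E d)), ⟪g x, gradient η x⟫_ℝ := by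
  let e : Fin d → E d := fun j => EuclideanSpace.single j 1
  let θ : Fin d → 𝓓(B, ℝ) := fun j => ⟨fun x => fderiv ℝ η x (e j),
    TestFunction.contDiff_fderiv_apply η (e j), η.hasCompactSupport.fderiv_apply ℝ _,
    (TestFunction.tsupport_fderiv_apply_subset η _).trans η.tsupport_subset⟩
  have hlap : ∀ x, Δ (η : E d → ℝ) x = ∑ j, fderiv ℝ (θ j) x (e j) := by
    intro x
    rw [InnerProductSpace.laplacian_eq_iteratedFDeriv_orthonormalBasis _
      (EuclideanSpace.basisFun (Fin d) ℝ)]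
    refine Finset.sum_congr rfl fun j _ => ?_
    rw [iteratedFDeriv_two_apply]
    have hdiff : DifferentiableAt ℝ (fderiv ℝ (η : E d → ℝ)) x :=
      ((η.contDiff.fderiv_right (m := (⊤ : ℕ∞)) (by simp)).differentiable
        (by simp)) x
    have h1 : fderiv ℝ (θ j) x (e j) = fderiv ℝ (fderiv ℝ (η : E d → ℝ)) x (e j) (e j) := by
      have h2 : (θ j : E d → ℝ) = fun y => fderiv ℝ (η : E d → ℝ) y (e j) := rfl
      rw [h2, fderiv_clm_apply hdiff (differentiableAt_const _)]
      simp
    rw [h1]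
    simp [e]
  have hinner : ∀ x, ⟪g x, gradient η x⟫_ℝ = ∑ j, g x j * θ j x := by
    intro x
    rw [PiLp.inner_apply]
    refine Finset.sum_congr rfl fun j _ => ?_
    rw [gradient_apply]
    exact mul_comm _ _
  simp_rw [hlap, hinner, Finset.mul_sum]
  rw [integral_finsetSum _ fun j _ => TestFunction.integrableOn_mul_fderiv h.locallyIntegrable _ _,
    integral_finsetSum _ fun j _ => TestFunction.integrableOn_mul
      (locallyIntegrableOn_coord h.locallyIntegrable_grad j) _, ← Finset.sum_neg_distrib]
  exact Finset.sum_congr rfl fun j _ => h.integral_eq (θ j) j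

lemma energy_add_smul {g k : E d → E d} (hg : MemLp g 2 (leb B)) (hk : MemLp k 2 (leb B)) (t : ℝ) :
    energy B p (fun x => g x + t • k x) = energy B p g
      + t * (p * ∫ x in (B : Set (E d)), ⟪g x, k x⟫_ℝ) + t ^ 2 * energy B p k := by
  have e1 : (eLpNorm (fun x => g x + t • k x) 2 (leb B)).toReal = ‖hg.toLp + t • hk.toLp‖ := by
    rw [← MemLp.toLp_const_smul, ← MemLp.toLp_add, Lp.norm_toLp]
    rfl
  have e2 : ∫ x in (B : Set (E d)), ⟪g x, k x⟫_ℝ = ⟪hg.toLp, hk.toLp⟫_ℝ := by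
    rw [L2.inner_def]
    refine integral_congr_ae ?_
    filter_upwards [hg.coeFn_toLp, hk.coeFn_toLp] with x h1 h2
    rw [h1, h2]
  rw [energy, energy, energy, e1, e2, ← Lp.norm_toLp g hg, ← Lp.norm_toLp k hk, norm_add_sq_real,
    inner_smul_right, norm_smul, mul_pow, Real.norm_eq_abs, sq_abs]
  ring

/-- The Euler–Lagrange equation of a minimiser. -/
lemma IsMinimiser.solvesPoisson (hp : 1 ≤ p) (hmeas : ∀ i, AEMeasurable (φ i) volume)
    (hnonneg : ∀ i x, 0 ≤ φ i x) (hbdd : ∀ i, ∃ M : ℝ, ∀ x, φ i x ≤ M)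
    (hcomp : ∀ i, HasCompactSupport (φ i)) {ψ : E d → ℝ} (h : IsMinimiser B p φ ψ) :
    SolvesPoisson B ((p : ℝ) / 2) ψ (rightHandSide B p φ ψ) := by
  obtain ⟨g, hD, hcon, hen⟩ := h
  have hψm : AEStronglyMeasurable ψ (leb B) := by
    have h1 := hD.weakGradient.locallyIntegrable.aestronglyMeasurable
    exact h1
  have hφm : ∀ i, AEStronglyMeasurable (φ i) (leb B) := fun i =>
    ((hmeas i).mono_measure Measure.restrict_le_self).aestronglyMeasurable
  have hfin : ∀ i, weightedNorm B p (φ i) ψ < ⊤ := by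
    intro i
    have h1 : weightedNorm B p (φ i) ψ ^ 2 ≤ 1 :=
      (Finset.single_le_sum (f := fun i => weightedNorm B p (φ i) ψ ^ 2) (fun _ _ => zero_le)
        (Finset.mem_univ i)).trans hcon.le
    by_contra htop
    rw [not_lt, top_le_iff] at htop
    rw [htop] at h1
    simp at h1
  have ha : ∀ i, MemLp (fun x => φ i x * ψ x) ((2 * p : ℕ) : ℝ≥0∞) (leb B) := fun i =>
    ⟨(hφm i).mul hψm, hfin i⟩
  have hφL : ∀ i (q : ℝ≥0∞), MemLp (φ i) q (leb B) := fun i q => by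
    obtain ⟨M, hM⟩ := hbdd i
    refine (hcomp i).memLp_of_bound (hφm i) M (Eventually.of_forall fun x => ?_)
    rw [Real.norm_of_nonneg (hnonneg i x)]
    exact hM x
  have hb : ∀ i (η : 𝓓(B, ℝ)), MemLp (fun x => φ i x * η x) ((2 * p : ℕ) : ℝ≥0∞) (leb B) := by
    intro i η
    obtain ⟨C, hC⟩ := η.continuous.bounded_above_of_compact_support η.hasCompactSupport
    obtain ⟨M, hM⟩ := hbdd i
    refine (hcomp i).mul_right.memLp_of_bound
      ((hφm i).mul η.continuous.aestronglyMeasurable) (M * C) (Eventually.of_forall fun x => ?_)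
    change ‖φ i x * η x‖ ≤ M * C
    rw [norm_mul, Real.norm_of_nonneg (hnonneg i x)]
    exact mul_le_mul (hM x) (hC x) (norm_nonneg _) ((hnonneg i x).trans (hM x))
  set N : Fin n → ℝ := fun i => (weightedNorm B p (φ i) ψ).toReal ^ (2 - 2 * (p : ℤ)) with hN
  have hpow : ∀ i x (y : ℝ), (φ i x * ψ x) ^ (2 * p - 1) * (φ i x * y)
      = ψ x ^ (2 * p - 1) * φ i x ^ (2 * p) * y := by
    intro i x y
    have : φ i x ^ (2 * p) = φ i x ^ (2 * p - 1) * φ i x := by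
      rw [← pow_succ]; congr 1; omega
    rw [this, mul_pow]
    ring
  have hrhs : ∀ x (y : ℝ), rightHandSide B p φ ψ x * y
      = Theta B p φ * ∑ i, N i * ((φ i x * ψ x) ^ (2 * p - 1) * (φ i x * y)) := by
    intro x y
    rw [rightHandSide, Finset.mul_sum, Finset.mul_sum, Finset.sum_mul]
    refine Finset.sum_congr rfl fun i _ => ?_
    rw [hpow]
    ring
  have h1p : 1 ≤ 2 * p := by omega
  refine ⟨hD.weakGradient.locallyIntegrable, ?_, fun η => ?_⟩
  · have e : rightHandSide B p φ ψ = fun x =>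
        Theta B p φ * ∑ i, N i * ((φ i x * ψ x) ^ (2 * p - 1) * φ i x) := by
      funext x
      have := hrhs x 1
      simpa using this
    have hint : IntegrableOn (rightHandSide B p φ ψ) (B : Set (E d)) volume := by
      rw [e]
      refine Integrable.const_mul (integrable_finsetSum _ fun i _ => Integrable.const_mul ?_ _) _
      exact (hasDerivAt_integral_add_mul_pow h1p (ha i) (hφL i _)).1
    exact hint.locallyIntegrableOn
  · -- perturb the minimiser in the direction `η`
    have hgL := hD.memLp_grad
    have hηL : MemLp (gradient η) 2 (leb B) := (TestFunction.memLp_gradient η 2).restrict _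
    set J : Fin n → ℝ := fun i =>
      ∫ x in (B : Set (E d)), (φ i x * ψ x) ^ (2 * p - 1) * (φ i x * η x) with hJ
    set I : ℝ := ∫ x in (B : Set (E d)), ⟪g x, gradient η x⟫_ℝ with hI
    have hpert : ∀ t : ℝ, HasDGradient B (fun x => ψ x + t * η x)
        (fun x => g x + t • gradient η x) := fun t => by
      simpa using hD.linearComb η 1 t
    have hwt : ∀ i (t : ℝ), weightedNorm B p (φ i) (fun x => ψ x + t * η x)
        = eLpNorm (fun x => φ i x * ψ x + t * (φ i x * η x)) ((2 * p : ℕ) : ℝ≥0∞) (leb B) := by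
      intro i t
      rw [weightedNorm]
      congr 1
      funext x
      ring
    have hwfin : ∀ i (t : ℝ), weightedNorm B p (φ i) (fun x => ψ x + t * η x) ≠ ⊤ := fun i t => by
      rw [hwt]
      exact ((ha i).add ((hb i η).const_mul t)).2.ne
    set F : ℝ → ℝ := fun t => energy B p (fun x => g x + t • gradient η x)
      - Theta B p φ * ∑ i, (weightedNorm B p (φ i) (fun x => ψ x + t * η x)).toReal ^ 2 with hF
    have hQreal : ∀ f : E d → ℝ, (∀ i, weightedNorm B p (φ i) f ≠ ⊤) →
        (constraintFun B p φ f).toReal = ∑ i, (weightedNorm B p (φ i) f).toReal ^ 2 := by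
      intro f hf
      rw [constraintFun, ENNReal.toReal_sum fun i _ => ENNReal.pow_ne_top (hf i)]
      simp only [ENNReal.toReal_pow]
    have hF0 : F 0 = 0 := by
      have h1 : (constraintFun B p φ ψ).toReal = 1 := by
        have : constraintFun B p φ ψ = 1 := hcon
        rw [this, ENNReal.toReal_one]
      rw [hQreal ψ fun i => (hfin i).ne] at h1
      simp only [hF, zero_smul, zero_mul, add_zero, h1, mul_one]
      exact sub_eq_zero.2 hen
    have hFnn : ∀ t, 0 ≤ F t := fun t => by
      have h1 := Theta_mul_le_energy (φ := φ) (p := p) (hpert t)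
        (ENNReal.sum_ne_top.2 fun i _ => ENNReal.pow_ne_top (hwfin i t))
      rw [hQreal _ fun i => hwfin i t] at h1
      exact sub_nonneg.2 h1
    have hmin : IsLocalMin F 0 := Eventually.of_forall fun t => by rw [hF0]; exact hFnn t
    have hder : HasDerivAt F (p * I - Theta B p φ * ∑ i, 2 * (N i * J i)) 0 := by
      refine HasDerivAt.sub ?_ ((HasDerivAt.fun_sum fun i _ => ?_).const_mul _)
      · have h1 : (fun t : ℝ => energy B p (fun x => g x + t • gradient η x))
            = fun t => energy B p g + t * (p * I) + t ^ 2 * energy B p (gradient η) :=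
          funext fun t => energy_add_smul hgL hηL t
        rw [h1]
        have h2 := (((hasDerivAt_id (0:ℝ)).mul_const (p * I)).const_add (energy B p g)).fun_add
          ((hasDerivAt_pow 2 (0:ℝ)).mul_const (energy B p (gradient η)))
        simpa using h2
      · simp_rw [hwt]
        exact hasDerivAt_toReal_eLpNorm_sq hp (ha i) (hb i η)
    have hzero := hmin.hasDerivAt_eq_zero hder
    have hR : ∫ x in (B : Set (E d)), rightHandSide B p φ ψ x * η x
        = Theta B p φ * ∑ i, N i * J i := by
      simp_rw [hrhs]
      rw [integral_const_mul, integral_finsetSum _ fun i _ => Integrable.const_mul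
        (hasDerivAt_integral_add_mul_pow h1p (ha i) (hb i η)).1 _]
      simp_rw [integral_const_mul]
      rfl
    rw [hR, hD.weakGradient.integral_mul_laplacian, ← hI]
    rw [← Finset.mul_sum] at hzero
    linarith

end

end IntersectionLocalTime

open IntersectionLocalTime in
theorem proposition1p3 {d : ℕ} (hd : 1 ≤ d) (p : ℕ) (hp : 1 ≤ p)
    (hpd : (p : ℤ) * ((d : ℤ) - 2) < (d : ℤ))
    (B : TopologicalSpace.Opens (EuclideanSpace ℝ (Fin d)))
    (hB : Bornology.IsBounded (B : Set (EuclideanSpace ℝ (Fin d))) ∨ (B = ⊤ ∧ 3 ≤ d))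
    (n : ℕ) (φ : Fin n → EuclideanSpace ℝ (Fin d) → ℝ)
    (hmeas : ∀ i, AEMeasurable (φ i) MeasureTheory.volume)
    (hnonneg : ∀ i x, 0 ≤ φ i x)
    (hbdd : ∀ i, ∃ M : ℝ, ∀ x, φ i x ≤ M)
    (hcomp : ∀ i, HasCompactSupport (φ i))
    (hsupp : ∀ i, tsupport (φ i) ⊆ (B : Set (EuclideanSpace ℝ (Fin d))))
    (hne : ∃ i, ¬ (φ i =ᵐ[MeasureTheory.volume] 0)) :
    (∃ ψ : EuclideanSpace ℝ (Fin d) → ℝ, IsMinimiser B p φ ψ) ∧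
    (∀ ψ : EuclideanSpace ℝ (Fin d) → ℝ, IsMinimiser B p φ ψ →
      SolvesPoisson B ((p : ℝ) / 2) ψ (rightHandSide B p φ ψ)) := by
  refine ⟨?_, fun ψ hψ => hψ.solvesPoisson hp hmeas hnonneg hbdd hcomp⟩
  obtain ⟨Λ, hΛ, hle, ψ, g, hD, hψ, hg⟩ :=
    exists_maximiser hd hp hpd hB hmeas hnonneg hbdd hcomp hsupp hne
  exact isMinimiser_of_maximiser hΛ (fun _ _ h => constraintFun_le_of_hasDGradient hmeas hle h)
    (fun _ _ h => h.memLp_grad.2.ne) hD hψ hg
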